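/- Let $d\ge 1$ be an integer and $\Xi=S^{d-1}\times\mathbb R$. Let $\mathcal S_0(\mathbb R^d)$ be the space of complex-valued Schwartz functions $\varphi$ on $\mathbb R^d$ with $\int_{\mathbb R^d}\varphi(x)p(x)\,dx=0$ for all polynomials $p$, with the topology of $\mathcal S(\mathbb R^d)$. Let $\mathcal S(\Xi)$ be the space of $\psi\in C^\infty(\Xi)$, complex-valued, for which all the seminorms $\sup_{(n,t)\in\Xi}(1+t^2)^{k/2}|\partial_t^l D\psi(n,t)|$ ($k,l\in\mathbb N$, $D$ a differential operator on $S^{d-1}$) are finite, with the topology generated by these seminorms, and let $\mathcal S_0(\Xi)$ be the subspace of those $\psi$ with $\int_{\mathbb R}\psi(n,t)p(t)\,dt=0$ for all polynomials $p$ and all $n\in S^{d-1}$. Put $\psi^\vee(n,t)=\psi(-n,-t)$ and $\mathcal S_0(\Xi)_{\rm even}=\{\psi\in\mathcal S_0(\Xi):\psi^\vee=\psi\}$. Let $\mathcal S_0'(\mathbb R^d)$ and $\mathcal S_0'(\Xi)$ be the topological duals (Lizorkin distributions), and $\mathcal S_0'(\Xi)_{\rm even}=\{g\in\mathcal S_0'(\Xi):\langle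 g,\psi^\vee\rangle=\langle g,\psi\rangle\ \forall\psi\in\mathcal S_0(\Xi)\}$. For test functions set $\mathcal R\varphi(n,t)=\int_{n\cdot x=t}\varphi\,dm$ with $m$ the Euclidean measure on the hyperplane, $\mathcal R^*\psi(x)=\int_{S^{d-1}}\psi(n,n\cdot x)\,dn$ with $dn$ the surface measure of the sphere, and $$\Lambda^{d-1}\psi=\begin{cases}(-1)^{\frac{d-1}{2}}\,\partial_t^{d-1}\psi & d\text{ odd},\\ (-1)^{\frac{d-2}{2}}\,\mathscr H\,\partial_t^{d-1}\psi & d\text{ even},\end{cases}$$ where $\mathscr H$ is the Hilbert transform in $t$, that is, the Fourier multiplier $-i\,\mathrm{sgn}(\omega)$ (with $\mathcal F u(\omega)=(2\pi)^{-1/2}\int u(t)e^{-i\omega t}dt$). Then the operators $$\mathcal R:\mathcal S_0'(\mathbb R^d)\to\mathcal S_0'(\Xi)_{\rm even},\qquad \mathcal R^*:\mathcal S_0'(\Xi)_{\rm even}\to\mathcal S_0'(\mathbb R^d),\qquad \Lambda^{d-1}:\mathcal S_0'(\Xi)_{\rm even}\to\mathcal S_0'(\Xi)_{\rm even}$$ are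 well defined by $\langle\mathcal Rf,\psi\rangle=\langle f,\mathcal R^*\psi\rangle$, $\langle\mathcal R^*g,\varphi\rangle=\langle g,\mathcal R\varphi\rangle$ and $\langle\Lambda^{d-1}g,\psi\rangle=\langle g,\Lambda^{d-1}\psi\rangle$ for $\psi\in\mathcal S_0(\Xi)_{\rm even}$, $\varphi\in\mathcal S_0(\mathbb R^d)$ (in particular $\mathcal R^*\psi\in\mathcal S_0(\mathbb R^d)$ and $\mathcal R\varphi,\Lambda^{d-1}\psi\in\mathcal S_0(\Xi)_{\rm even}$), and they satisfy the following. For every $f\in\mathcal S_0'(\mathbb R^d)$, $$f=\frac{1}{2(2\pi)^{d-1}}\,\mathcal R^*\Lambda^{d-1}\mathcal R f .$$ For every $g\in\mathcal S_0'(\Xi)_{\rm even}$, $$g=\frac{1}{2(2\pi)^{d-1}}\,\Lambda^{d-1}\mathcal R\mathcal R^* g .$$ -/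

import Mathlib

open MeasureTheory
open scoped Manifold ContDiff SchwartzMap FourierTransform

noncomputable section

namespace LizorkinRadon

/-! ### The spaces `ℝ^d`, `S^{d-1}` and `Ξ = S^{d-1} × ℝ` -/

/-- The Euclidean space `ℝ^d`. -/
abbrev E (d : ℕ) : Type := EuclideanSpace ℝ (Fin d)

/-- The unit sphere `S^{d-1}` of `ℝ^d`. -/
abbrev Sph (d : ℕ) : Type := Metric.sphere (0 : E d) 1

/-- The space `Ξ = S^{d-1} × ℝ`. -/
abbrev Xi (d : ℕ) : Type := Sph d × ℝ

/-- For `d ≥ 1` the sphere `S^{d-1}` is a manifold modelled on `ℝ^{d-1}`. -/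
instance factFinrank (d : ℕ) [NeZero d] : Fact (Module.finrank ℝ (E d) = d - 1 + 1) :=
  ⟨by rw [finrank_euclideanSpace_fin]; exact (Nat.sub_add_cancel (NeZero.one_le)).symm⟩

/-- Smooth functions on the product manifold `Ξ = S^{d-1} × ℝ`. -/
def IsSmoothXi {d : ℕ} [NeZero d] (ψ : Xi d → ℂ) : Prop :=
  ContMDiff ((𝓡 (d - 1)).prod 𝓘(ℝ, ℝ)) 𝓘(ℝ, ℂ) ∞ ψ

/-! ### The Schwartz space `𝓢(Ξ)` -/

/-- The extension of a function on `Ξ = S^{d-1} × ℝ` to `(ℝ^d ∖ {0}) × ℝ` that is homogeneous of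
degree `0` in the first variable, `(x, t) ↦ ψ (x / |x|, t)` (with value `0` at `x = 0`). -/
def homExt {d : ℕ} (ψ : Xi d → ℂ) : E d × ℝ → ℂ := fun p =>
  open Classical in
  if h : p.1 ≠ 0 then ψ (⟨‖p.1‖⁻¹ • p.1, by simp [norm_smul, h]⟩, p.2) else 0

theorem homExt_coe {d : ℕ} (ψ : Xi d → ℂ) (n : Sph d) (t : ℝ) :
    homExt ψ ((n : E d), t) = ψ (n, t) := by
  have h1 : ‖(n : E d)‖ = 1 := norm_eq_of_mem_sphere n
  have h0 : (n : E d) ≠ 0 := fun h => by simp [h] at h1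
  simp [homExt, h0]

theorem homExt_add {d : ℕ} (ψ χ : Xi d → ℂ) : homExt (ψ + χ) = homExt ψ + homExt χ := by
  funext p
  by_cases h : p.1 = 0 <;> simp [homExt, h]

theorem homExt_smul {d : ℕ} (c : ℂ) (ψ : Xi d → ℂ) : homExt (c • ψ) = c • homExt ψ := by
  funext p
  by_cases h : p.1 = 0 <;> simp [homExt, h]

theorem homExt_zero {d : ℕ} : homExt (0 : Xi d → ℂ) = 0 := by
  funext p
  by_cases h : p.1 = 0 <;> simp [homExt, h]

/-- The homogeneous extension of a smooth function is smooth off `{0} × ℝ`. -/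
theorem contDiffAt_homExt {d : ℕ} [NeZero d] {ψ : Xi d → ℂ} (hψ : IsSmoothXi ψ)
    {p : E d × ℝ} (hp : p.1 ≠ 0) : ContDiffAt ℝ ∞ (homExt ψ) p := by
  let U : TopologicalSpace.Opens (E d × ℝ) :=
    ⟨{q | q.1 ≠ 0}, isOpen_ne.preimage continuous_fst⟩
  let f : U → E d := fun q => ‖(q : E d × ℝ).1‖⁻¹ • (q : E d × ℝ).1
  have hf' : ∀ q, f q ∈ Metric.sphere (0 : E d) 1 := by
    rintro ⟨q, hq⟩
    have hq' : q.1 ≠ 0 := hq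
    simp [f, norm_smul, hq']
  have hf : ContMDiff 𝓘(ℝ, E d × ℝ) 𝓘(ℝ, E d) ∞ f := by
    intro q
    have hq' : (q : E d × ℝ).1 ≠ 0 := q.2
    refine (contMDiffAt_subtype_iff (I := 𝓘(ℝ, E d × ℝ))
      (f := fun r : E d × ℝ => ‖r.1‖⁻¹ • r.1)).2 ?_
    refine ContDiffAt.contMDiffAt ?_
    exact ((contDiffAt_fst.norm ℝ hq').inv (norm_ne_zero_iff.2 hq')).smul contDiffAt_fst
  have hg := ContMDiff.codRestrict_sphere (n := d - 1) hf hf'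
  have ht : ContMDiff 𝓘(ℝ, E d × ℝ) 𝓘(ℝ, ℝ) ∞ (fun q : U => (q : E d × ℝ).2) := fun q =>
    (contMDiffAt_subtype_iff (I := 𝓘(ℝ, E d × ℝ)) (f := fun r : E d × ℝ => r.2)).2
      contDiffAt_snd.contMDiffAt
  have hc := ContMDiff.comp (I' := (𝓡 (d - 1)).prod 𝓘(ℝ, ℝ)) hψ (hg.prodMk ht)
  have hpt := hc ⟨p, hp⟩
  have key : ContMDiffAt 𝓘(ℝ, E d × ℝ) 𝓘(ℝ, ℂ) ∞ (homExt ψ) p := by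
    refine (contMDiffAt_subtype_iff (I := 𝓘(ℝ, E d × ℝ)) (U := U) (x := ⟨p, hp⟩)).1 ?_
    convert hpt using 1
    funext q
    have hq' : (q : E d × ℝ).1 ≠ 0 := q.2
    simp only [homExt, ne_eq, hq', not_false_eq_true, dif_pos, Function.comp]
    rfl
  exact key.contDiffAt

theorem contDiffAt_homExt_coe {d : ℕ} [NeZero d] {ψ : Xi d → ℂ} (hψ : IsSmoothXi ψ)
    (n : Sph d) (t : ℝ) (m : ℕ) : ContDiffAt ℝ m (homExt ψ) ((n : E d), t) := by
  have h1 : ‖(n : E d)‖ = 1 := norm_eq_of_mem_sphere n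
  have h0 : (n : E d) ≠ 0 := fun h => by simp [h] at h1
  exact (contDiffAt_homExt hψ (p := ((n : E d), t)) h0).of_le (by exact_mod_cast le_top)

/-- The weighted size `⟨t⟩^k |∇^m ψ (n, t)|` of the derivatives of `ψ` of order `m` at
`(n, t) ∈ Ξ`, where `⟨t⟩ = (1 + t²)^{1/2}` and `∇^m ψ` is the total derivative of order `m` of the
homogeneous extension of `ψ`. The operators `∂_t^l D`, with `D` a differential operator on the
compact manifold `S^{d-1}`, are exactly the linear combinations, with coefficients that are smooth
functions on `S^{d-1}`, of the restrictions to `Ξ` of the partial derivatives of the homogeneous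
extension. Hence the suprema over `Ξ` of these weighted sizes, for all `k` and `m`, are finite
exactly if all suprema of `⟨t⟩^k |∂_t^l D ψ|` are, and both families define the same topology. -/
def decayAt {d : ℕ} (k m : ℕ) (ψ : Xi d → ℂ) (ξ : Xi d) : ℝ :=
  Real.sqrt (1 + ξ.2 ^ 2) ^ k * ‖iteratedFDeriv ℝ m (homExt ψ) ((ξ.1 : E d), ξ.2)‖

theorem decayAt_nonneg {d : ℕ} (k m : ℕ) (ψ : Xi d → ℂ) (ξ : Xi d) : 0 ≤ decayAt k m ψ ξ := by
  unfold decayAt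
  positivity

theorem decayAt_zero {d : ℕ} (k m : ℕ) (ξ : Xi d) : decayAt k m 0 ξ = 0 := by
  have : (0 : E d × ℝ → ℂ) = fun _ => 0 := rfl
  simp [decayAt, homExt_zero, this]

theorem decayAt_add_le {d : ℕ} [NeZero d] (k m : ℕ) {ψ χ : Xi d → ℂ} (hψ : IsSmoothXi ψ)
    (hχ : IsSmoothXi χ) (ξ : Xi d) :
    decayAt k m (ψ + χ) ξ ≤ decayAt k m ψ ξ + decayAt k m χ ξ := by
  unfold decayAt
  rw [homExt_add, iteratedFDeriv_add_apply (contDiffAt_homExt_coe hψ ξ.1 ξ.2 m)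
    (contDiffAt_homExt_coe hχ ξ.1 ξ.2 m), ← mul_add]
  gcongr
  exact norm_add_le _ _

theorem decayAt_smul {d : ℕ} [NeZero d] (k m : ℕ) (c : ℂ) {ψ : Xi d → ℂ} (hψ : IsSmoothXi ψ)
    (ξ : Xi d) : decayAt k m (c • ψ) ξ = ‖c‖ * decayAt k m ψ ξ := by
  unfold decayAt
  rw [homExt_smul, iteratedFDeriv_const_smul_apply (contDiffAt_homExt_coe hψ ξ.1 ξ.2 m),
    norm_smul]
  ring

/-- The vector space underlying `𝓢(Ξ)`: smooth functions on `Ξ` which decay rapidly in `t`,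
uniformly in `n`, together with all their derivatives. -/
def schwartzXiSubmodule (d : ℕ) [NeZero d] : Submodule ℂ (Xi d → ℂ) where
  carrier := {ψ | IsSmoothXi ψ ∧ ∀ k m : ℕ, ∃ C : ℝ, ∀ ξ : Xi d, decayAt k m ψ ξ ≤ C}
  add_mem' := by
    rintro ψ χ ⟨hψ, hψ'⟩ ⟨hχ, hχ'⟩
    refine ⟨ContMDiff.add hψ hχ, fun k m => ?_⟩
    obtain ⟨C, hC⟩ := hψ' k m
    obtain ⟨D, hD⟩ := hχ' k m
    exact ⟨C + D, fun ξ => (decayAt_add_le k m hψ hχ ξ).trans (add_le_add (hC ξ) (hD ξ))⟩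
  zero_mem' := ⟨contMDiff_const (c := (0 : ℂ)), fun k m => ⟨0, fun ξ => (decayAt_zero k m ξ).le⟩⟩
  smul_mem' := by
    rintro c ψ ⟨hψ, hψ'⟩
    refine ⟨(contDiff_const_smul (𝕜 := ℝ) (F := ℂ) (n := ∞) c).contMDiff.comp
      (show ContMDiff ((𝓡 (d - 1)).prod 𝓘(ℝ, ℝ)) 𝓘(ℝ, ℂ) ∞ ψ from hψ), fun k m => ?_⟩
    obtain ⟨C, hC⟩ := hψ' k m
    refine ⟨‖c‖ * C, fun ξ => ?_⟩
    rw [decayAt_smul k m c hψ ξ]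
    exact mul_le_mul_of_nonneg_left (hC ξ) (norm_nonneg c)

/-- The Schwartz space `𝓢(Ξ)`. It is a separate type, so that it does not inherit the topology of
pointwise convergence from `Ξ → ℂ`. -/
def SchwartzXi (d : ℕ) [NeZero d] : Type := schwartzXiSubmodule d

section SchwartzXi

variable {d : ℕ} [NeZero d]

instance : AddCommGroup (SchwartzXi d) := inferInstanceAs (AddCommGroup (schwartzXiSubmodule d))

instance : Module ℂ (SchwartzXi d) := inferInstanceAs (Module ℂ (schwartzXiSubmodule d))

instance : FunLike (SchwartzXi d) (Xi d) ℂ where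
  coe ψ := ψ.1
  coe_injective _ _ h := Subtype.ext h

theorem SchwartzXi.coe_add (ψ χ : SchwartzXi d) : ⇑(ψ + χ) = ⇑ψ + ⇑χ := rfl

theorem SchwartzXi.coe_smul (c : ℂ) (ψ : SchwartzXi d) : ⇑(c • ψ) = c • ⇑ψ := rfl

theorem SchwartzXi.coe_zero : ⇑(0 : SchwartzXi d) = 0 := rfl

theorem SchwartzXi.smooth (ψ : SchwartzXi d) : IsSmoothXi (ψ : Xi d → ℂ) := ψ.2.1

theorem SchwartzXi.bddAbove (ψ : SchwartzXi d) (k m : ℕ) :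
    BddAbove (Set.range (decayAt k m ψ)) := by
  obtain ⟨C, hC⟩ := ψ.2.2 k m
  exact ⟨C, by rintro _ ⟨ξ, rfl⟩; exact hC ξ⟩

/-- The seminorms `sup_{(n, t) ∈ Ξ} ⟨t⟩^k |∇^m ψ (n, t)|` of `𝓢(Ξ)`. -/
def SchwartzXi.seminorm (d : ℕ) [NeZero d] (k m : ℕ) : Seminorm ℂ (SchwartzXi d) :=
  Seminorm.ofSMulLE (fun ψ => ⨆ ξ : Xi d, decayAt k m ψ ξ)
    (by simp [SchwartzXi.coe_zero, decayAt_zero])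
    (fun ψ χ => by
      refine Real.iSup_le (fun ξ => ?_)
        (add_nonneg (Real.iSup_nonneg fun ξ => decayAt_nonneg k m ψ ξ)
          (Real.iSup_nonneg fun ξ => decayAt_nonneg k m χ ξ))
      exact (decayAt_add_le k m ψ.smooth χ.smooth ξ).trans
        (add_le_add (le_ciSup (ψ.bddAbove k m) ξ) (le_ciSup (χ.bddAbove k m) ξ)))
    (fun c ψ => by
      refine Real.iSup_le (fun ξ => ?_)
        (mul_nonneg (norm_nonneg c) (Real.iSup_nonneg fun ξ => decayAt_nonneg k m ψ ξ))
      rw [SchwartzXi.coe_smul, decayAt_smul k m c ψ.smooth ξ]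
      exact mul_le_mul_of_nonneg_left (le_ciSup (ψ.bddAbove k m) ξ) (norm_nonneg c))

/-- The family of seminorms of `𝓢(Ξ)`. -/
def schwartzXiSeminormFamily (d : ℕ) [NeZero d] : SeminormFamily ℂ (SchwartzXi d) (ℕ × ℕ) :=
  fun i => SchwartzXi.seminorm d i.1 i.2

/-- `𝓢(Ξ)` carries the locally convex topology generated by its seminorms. -/
instance : TopologicalSpace (SchwartzXi d) := (schwartzXiSeminormFamily d).moduleFilterBasis.topology

theorem schwartzXi_withSeminorms (d : ℕ) [NeZero d] :
    WithSeminorms (schwartzXiSeminormFamily d) := ⟨rfl⟩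

theorem SchwartzXi.continuous_slice (ψ : SchwartzXi d) (n : Sph d) :
    Continuous fun t : ℝ => ψ (n, t) :=
  (ContMDiff.continuous ψ.smooth).comp (by fun_prop)

theorem SchwartzXi.integrable_mul_polynomial (ψ : SchwartzXi d) (n : Sph d) (p : Polynomial ℂ) :
    Integrable fun t : ℝ => ψ (n, t) * p.eval (t : ℂ) := by
  induction p using Polynomial.induction_on' with
  | add p q hp hq =>
    simp only [Polynomial.eval_add, mul_add]
    exact hp.add hq
  | monomial k a =>
    obtain ⟨C, hC⟩ := ψ.2.2 (k + 2) 0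
    refine (integrable_inv_one_add_sq.const_mul (C * ‖a‖)).mono'
      (by
        refine Continuous.aestronglyMeasurable ?_
        have := ψ.continuous_slice n
        simp only [Polynomial.eval_monomial]
        exact this.mul (by fun_prop)) (Filter.Eventually.of_forall fun t => ?_)
    have h := hC (n, t)
    have hs : 0 < 1 + t ^ 2 := by positivity
    have hsq : Real.sqrt (1 + t ^ 2) ^ 2 = 1 + t ^ 2 := Real.sq_sqrt hs.le
    have ht : |t| ≤ Real.sqrt (1 + t ^ 2) := Real.abs_le_sqrt (by linarith)
    have hval : ‖iteratedFDeriv ℝ 0 (homExt ψ) ((n : E d), t)‖ = ‖ψ (n, t)‖ := by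
      rw [norm_iteratedFDeriv_zero, homExt_coe]
    have h' : Real.sqrt (1 + t ^ 2) ^ k * (1 + t ^ 2) * ‖ψ (n, t)‖ ≤ C := by
      have h2 : Real.sqrt (1 + t ^ 2) ^ (k + 2) *
          ‖iteratedFDeriv ℝ 0 (homExt ψ) ((n : E d), t)‖ ≤ C := h
      rwa [hval, pow_add, hsq] at h2
    have hk : |t| ^ k ≤ Real.sqrt (1 + t ^ 2) ^ k := by gcongr
    have h3 : |t| ^ k * ‖ψ (n, t)‖ ≤ C * (1 + t ^ 2)⁻¹ := by
      rw [← div_eq_mul_inv, le_div_iff₀ hs]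
      refine le_trans ?_ h'
      have := mul_le_mul_of_nonneg_right hk
        (mul_nonneg hs.le (norm_nonneg (ψ (n, t))))
      nlinarith [this]
    have h4 : ‖ψ (n, t) * (Polynomial.monomial k a).eval (t : ℂ)‖
        = ‖a‖ * (|t| ^ k * ‖ψ (n, t)‖) := by
      simp
      ring
    rw [h4]
    calc ‖a‖ * (|t| ^ k * ‖ψ (n, t)‖) ≤ ‖a‖ * (C * (1 + t ^ 2)⁻¹) := by gcongr
      _ = C * ‖a‖ * (1 + t ^ 2)⁻¹ := by ring

end SchwartzXi

/-! ### Lizorkin test functions -/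

theorem integrable_mul_mvPolynomial {d : ℕ} (φ : 𝓢(E d, ℂ)) (p : MvPolynomial (Fin d) ℂ) :
    Integrable fun x : E d => φ x * MvPolynomial.eval (fun i => (x i : ℂ)) p := by
  have hp : (fun x : E d => MvPolynomial.eval (fun i => (x i : ℂ)) p).HasTemperateGrowth := by
    induction p using MvPolynomial.induction_on with
    | C a => simp
    | add p q hp hq =>
      simp only [map_add]
      exact hp.add hq
    | mul_X p i hp =>
      simp only [map_mul, MvPolynomial.eval_X]
      refine hp.mul ?_
      exact (Complex.ofRealCLM.comp (EuclideanSpace.proj i : E d →L[ℝ] ℝ)).hasTemperateGrowth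
  have h := (SchwartzMap.smulLeftCLM ℂ
    (fun x : E d => MvPolynomial.eval (fun i => (x i : ℂ)) p) φ).integrable (μ := volume)
  refine h.congr (Filter.Eventually.of_forall fun x => ?_)
  rw [SchwartzMap.smulLeftCLM_apply_apply hp]
  simp [mul_comm]

/-- The Lizorkin test function space `𝓢₀(ℝ^d)`: the Schwartz functions that are orthogonal to all
polynomials, with the topology induced by `𝓢(ℝ^d)`. -/
def LizorkinE (d : ℕ) : Submodule ℂ 𝓢(E d, ℂ) where
  carrier := {φ | ∀ p : MvPolynomial (Fin d) ℂ,
    ∫ x : E d, φ x * MvPolynomial.eval (fun i => (x i : ℂ)) p = 0}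
  add_mem' := by
    intro φ χ hφ hχ p
    have := integral_add (integrable_mul_mvPolynomial φ p) (integrable_mul_mvPolynomial χ p)
    rw [hφ p, hχ p] at this
    simpa [add_mul] using this
  zero_mem' := by intro p; simp
  smul_mem' := by
    intro c φ hφ p
    have := integral_const_mul (μ := volume) c
      (fun x : E d => φ x * MvPolynomial.eval (fun i => (x i : ℂ)) p)
    rw [hφ p] at this
    simpa [mul_assoc] using this

/-- The Lizorkin test function space `𝓢₀(Ξ)`: the functions in `𝓢(Ξ)` that are orthogonal to all
polynomials in `t`, for every `n`, with the topology induced by `𝓢(Ξ)`. -/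
def LizorkinXi (d : ℕ) [NeZero d] : Submodule ℂ (SchwartzXi d) where
  carrier := {ψ | ∀ (p : Polynomial ℂ) (n : Sph d), ∫ t : ℝ, ψ (n, t) * p.eval (t : ℂ) = 0}
  add_mem' := by
    intro ψ χ hψ hχ p n
    have := integral_add (ψ.integrable_mul_polynomial n p) (χ.integrable_mul_polynomial n p)
    rw [hψ p n, hχ p n] at this
    simpa [SchwartzXi.coe_add, add_mul] using this
  zero_mem' := by intro p n; simp [SchwartzXi.coe_zero]
  smul_mem' := by
    intro c ψ hψ p n
    have := integral_const_mul (μ := volume) c (fun t : ℝ => ψ (n, t) * p.eval (t : ℂ))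
    rw [hψ p n] at this
    simpa [SchwartzXi.coe_smul, mul_assoc] using this

/-! ### Parity -/

/-- The reflection `ψ^∨ (n, t) = ψ (-n, -t)`. -/
def reflect {d : ℕ} (ψ : Xi d → ℂ) : Xi d → ℂ := fun ξ => ψ (-ξ.1, -ξ.2)

theorem homExt_reflect {d : ℕ} (ψ : Xi d → ℂ) :
    homExt (reflect ψ) = homExt ψ ∘ LinearIsometryEquiv.neg ℝ (E := E d × ℝ) := by
  funext p
  change homExt (reflect ψ) p = homExt ψ (-p)
  by_cases h : p.1 = 0
  · simp [homExt, h]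
  · have h' : (-p).1 ≠ 0 := by simpa using h
    unfold homExt
    rw [dif_pos h, dif_pos h']
    unfold reflect
    congr 2
    exact Subtype.ext (by simp [norm_neg])

theorem decayAt_reflect {d : ℕ} (k m : ℕ) (ψ : Xi d → ℂ) (ξ : Xi d) :
    decayAt k m (reflect ψ) ξ = decayAt k m ψ (-ξ.1, -ξ.2) := by
  unfold decayAt
  rw [homExt_reflect, LinearIsometryEquiv.norm_iteratedFDeriv_comp_right]
  simp

/-- The reflection as a map of `𝓢(Ξ)` into itself. -/
def SchwartzXi.reflect {d : ℕ} [NeZero d] (ψ : SchwartzXi d) : SchwartzXi d :=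
  ⟨LizorkinRadon.reflect ψ,
    ContMDiff.comp (I' := (𝓡 (d - 1)).prod 𝓘(ℝ, ℝ)) ψ.smooth
      ((contMDiff_neg_sphere.comp contMDiff_fst).prodMk
        (contDiff_neg.contMDiff.comp contMDiff_snd)),
    fun k m => (ψ.2.2 k m).imp fun C hC ξ => by
      rw [decayAt_reflect]
      exact hC _⟩

theorem SchwartzXi.reflect_apply {d : ℕ} [NeZero d] (ψ : SchwartzXi d) (ξ : Xi d) :
    SchwartzXi.reflect ψ ξ = ψ (-ξ.1, -ξ.2) := rfl

/-- The reflection as a map of `𝓢₀(Ξ)` into itself. -/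
def reflectLizorkin {d : ℕ} [NeZero d] (ψ : LizorkinXi d) : LizorkinXi d :=
  ⟨SchwartzXi.reflect ψ.1, by
    intro p n
    have h := ψ.2 (p.comp (-Polynomial.X)) (-n)
    rw [← integral_neg_eq_self] at h
    simpa [SchwartzXi.reflect_apply] using h⟩

/-- The even Lizorkin test functions `𝓢₀(Ξ)_even`, those with `ψ^∨ = ψ`. -/
def LizorkinXiEven (d : ℕ) [NeZero d] : Set (LizorkinXi d) := {ψ | reflectLizorkin ψ = ψ}

/-! ### Lizorkin distributions -/

/-- The space `𝓢₀'(ℝ^d)` of Lizorkin distributions on `ℝ^d`. -/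
abbrev LizorkinDistE (d : ℕ) : Type := LizorkinE d →L[ℂ] ℂ

/-- The space `𝓢₀'(Ξ)` of Lizorkin distributions on `Ξ`. -/
abbrev LizorkinDistXi (d : ℕ) [NeZero d] : Type := LizorkinXi d →L[ℂ] ℂ

/-- The space `𝓢₀'(Ξ)_even` of even Lizorkin distributions on `Ξ`, those with `g^∨ = g`, where
`⟨g^∨, ψ⟩ = ⟨g, ψ^∨⟩`. -/
def LizorkinDistXiEven (d : ℕ) [NeZero d] : Submodule ℂ (LizorkinDistXi d) where
  carrier := {g | ∀ ψ : LizorkinXi d, g (reflectLizorkin ψ) = g ψ}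
  add_mem' := by intro g h hg hh ψ; simp [hg ψ, hh ψ]
  zero_mem' := by intro ψ; simp
  smul_mem' := by intro c g hg ψ; simp [hg ψ]

/-! ### The operators on functions -/

/-- The Radon transform `𝓡 φ (n, t) = ∫_{n · x = t} φ(x) dm(x)`. The hyperplane `n · x = t` is
`t n + n^⊥`, and its Euclidean measure is the translate of the volume of the Euclidean space
`n^⊥`. -/
def radon {d : ℕ} (φ : E d → ℂ) : Xi d → ℂ := fun ξ =>
  ∫ y : (Submodule.span ℝ {(ξ.1 : E d)})ᗮ, φ (ξ.2 • (ξ.1 : E d) + (y : E d))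

/-- The dual Radon transform `𝓡* ψ (x) = ∫_{S^{d-1}} ψ (n, n · x) dn`, with respect to the
spherical surface measure. -/
def dualRadon {d : ℕ} (ψ : Xi d → ℂ) : E d → ℂ := fun x =>
  ∫ n : Sph d, ψ (n, inner ℝ n.1 x) ∂(Measure.toSphere (volume : Measure (E d)))

/-- The Hilbert transform, with Fourier multiplier `-i sgn`. -/
def hilbert (u : ℝ → ℂ) : ℝ → ℂ :=
  𝓕⁻ (fun s : ℝ => -Complex.I * (Real.sign s : ℂ) * 𝓕 u s)

/-- The ramp filter `Λ^{d-1}`, acting on the variable `t`: it is `(-1)^{(d-1)/2} ∂_t^{d-1}` for odd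
`d` and `(-1)^{(d-2)/2} 𝓗 ∂_t^{d-1}` for even `d`. -/
def ramp {d : ℕ} (ψ : Xi d → ℂ) : Xi d → ℂ := fun ξ =>
  open Classical in
  if Odd d then (-1) ^ ((d - 1) / 2) * iteratedDeriv (d - 1) (fun s => ψ (ξ.1, s)) ξ.2
  else (-1) ^ ((d - 2) / 2) * hilbert (iteratedDeriv (d - 1) (fun s => ψ (ξ.1, s))) ξ.2

/-! ### The operators on distributions -/

section Distributions

variable {d : ℕ} [NeZero d]

/-- `F = 𝓡 f`: for every `ψ ∈ 𝓢₀(Ξ)_even` the function `𝓡* ψ` is in `𝓢₀(ℝ^d)` and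
`⟨F, ψ⟩ = ⟨f, 𝓡* ψ⟩`. -/
def IsRadon (f : LizorkinDistE d) (F : LizorkinDistXiEven d) : Prop :=
  ∀ ψ ∈ LizorkinXiEven d, ∃ φ : LizorkinE d,
    (∀ x : E d, φ.1 x = dualRadon ψ.1 x) ∧ F.1 ψ = f φ

/-- `h = 𝓡* g`: for every `φ ∈ 𝓢₀(ℝ^d)` the function `𝓡 φ` is in `𝓢₀(Ξ)_even` and
`⟨h, φ⟩ = ⟨g, 𝓡 φ⟩`. -/
def IsDualRadon (g : LizorkinDistXiEven d) (h : LizorkinDistE d) : Prop :=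
  ∀ φ : LizorkinE d, ∃ ψ ∈ LizorkinXiEven d,
    (∀ ξ : Xi d, ψ.1 ξ = radon φ.1 ξ) ∧ h φ = g.1 ψ

/-- `G = Λ^{d-1} g`: for every `ψ ∈ 𝓢₀(Ξ)_even` the function `Λ^{d-1} ψ` is in `𝓢₀(Ξ)_even` and
`⟨G, ψ⟩ = ⟨g, Λ^{d-1} ψ⟩`. -/
def IsRamp (g G : LizorkinDistXiEven d) : Prop :=
  ∀ ψ ∈ LizorkinXiEven d, ∃ χ ∈ LizorkinXiEven d,
    (∀ ξ : Xi d, χ.1 ξ = ramp ψ.1 ξ) ∧ G.1 ψ = g.1 χ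

open Classical in
/-- The Radon transform `𝓡 : 𝓢₀'(ℝ^d) → 𝓢₀'(Ξ)_even`. -/
def radonDist (f : LizorkinDistE d) : LizorkinDistXiEven d :=
  if h : ∃ F, IsRadon f F then h.choose else 0

open Classical in
/-- The dual Radon transform `𝓡* : 𝓢₀'(Ξ)_even → 𝓢₀'(ℝ^d)`. -/
def dualRadonDist (g : LizorkinDistXiEven d) : LizorkinDistE d :=
  if h : ∃ k, IsDualRadon g k then h.choose else 0

open Classical in
/-- The ramp filter `Λ^{d-1} : 𝓢₀'(Ξ)_even → 𝓢₀'(Ξ)_even`. -/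
def rampDist (g : LizorkinDistXiEven d) : LizorkinDistXiEven d :=
  if h : ∃ G, IsRamp g G then h.choose else 0

end Distributions

end LizorkinRadon

end

noncomputable section

namespace LizorkinRadon

/-! ### Continuity criteria -/

section Criteria

variable {X : Type*} [AddCommGroup X] [Module ℂ X] [TopologicalSpace X]
  [IsTopologicalAddGroup X]

/-! Everything is read off on the Fourier side. Evenness of ψ says that its Fourier transform in t,
at (n, w), depends only on the point wn of ℝ^d; so even functions on Ξ correspond to functions on
ℝ^d written in polar coordinates. Vanishing moments become vanishing to infinite order at w = 0, and
this makes both the singularity of polar coordinates and division by powers of |x| harmless.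

Two continuous operators carry the argument. `synthesis` sends h to the function on Ξ whose Fourier
transform on the line over n is w ↦ h(wn). `analysis` sends ψ to |x|^(1-d) times its Fourier
transform in polar coordinates. On flat h, `analysis` after `synthesis` is multiplication by
|x|^(1-d) (`analysis_synthesis`). With 𝓕 the Fourier transform on ℝ^d, the three operators on test
functions are: the Radon transform, `synthesis` after 𝓕 (Fourier slice theorem,
`radon_eq_synthesis`); the dual transform on even ψ, twice 𝓕⁻¹ after `analysis` (`dualRadon_eq`),
where the Jacobian r^(d-1) cancels the weight and the 2 comes from the two halves of each line; the
ramp filter on even ψ, the multiplier (2π|w|)^(d-1) (`ramp_eq_fourierInv`, `ramp_eq_rampCLM`).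
Powers of |x| cancel in the composites, leaving the constant 2(2π)^(d-1): see
`dualRadonCLM_rampCLM_radonCLM` and `radonCLM_dualRadonCLM_rampCLM`.

Most of the work is continuity. Charts on the sphere are avoided by `extendXi` and `restrictXi`,
which pass to Schwartz functions on ℝ^d × ℝ and back. The partial Fourier transform and the passage
to polar coordinates are each differentiated by a rule that reproduces the same operator on
vector-valued Schwartz functions, so induction on the order gives all seminorm bounds.

Finally, an even distribution is determined by its values on even test functions, and any continuous
functional restricted to these extends uniquely to an even one (`existsUnique_eq_on_even`). The
operators on distributions are therefore transposes, and the inversion formulae are the transposed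
test-function identities. -/

theorem continuous_of_seminorm_le {Y ι : Type*} [AddCommGroup Y] [Module ℂ Y]
    [TopologicalSpace Y] {p : SeminormFamily ℂ Y ι} (hp : WithSeminorms p) (f : X →ₗ[ℂ] Y)
    (h : ∀ i, ∃ q : X → ℝ, Continuous q ∧ q 0 = 0 ∧ ∀ x, p i (f x) ≤ q x) : Continuous f := by
  refine hp.continuous_of_continuous_comp f fun i => ?_
  obtain ⟨q, hq, hq0, hle⟩ := h i
  refine Seminorm.continuous_of_continuousAt_zero ?_
  have h0 : ((p i).comp f) 0 = 0 := map_zero _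
  rw [ContinuousAt, h0]
  have hq' : Filter.Tendsto q (nhds 0) (nhds 0) := by simpa [hq0] using hq.tendsto 0
  exact squeeze_zero (fun x => apply_nonneg _ _) hle hq'

/-- A linear map into a Schwartz space, from bounds by continuous functions vanishing at `0`. -/
def schwartzCLM {D G : Type*} [NormedAddCommGroup D] [NormedSpace ℝ D] [NormedAddCommGroup G]
    [NormedSpace ℂ G] (A : X → D → G) (hadd : ∀ f g x, A (f + g) x = A f x + A g x)
    (hsmul : ∀ (a : ℂ) f x, A (a • f) x = a • A f x) (hsmooth : ∀ f, ContDiff ℝ ∞ (A f))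
    (hbound : ∀ k n : ℕ, ∃ q : X → ℝ, Continuous q ∧ q 0 = 0 ∧
      ∀ f x, ‖x‖ ^ k * ‖iteratedFDeriv ℝ n (A f) x‖ ≤ q f) : X →L[ℂ] 𝓢(D, G) where
  toFun f :=
    { toFun := A f
      smooth' := hsmooth f
      decay' := fun k n => (hbound k n).elim fun q hq => ⟨q f, hq.2.2 f⟩ }
  map_add' f g := SchwartzMap.ext (hadd f g)
  map_smul' a f := SchwartzMap.ext (hsmul a f)
  cont := by
    refine continuous_of_seminorm_le (schwartz_withSeminorms ℂ D G)
      { toFun := fun f =>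
          ({ toFun := A f
             smooth' := hsmooth f
             decay' := fun k n => (hbound k n).elim fun q hq => ⟨q f, hq.2.2 f⟩ } : 𝓢(D, G))
        map_add' := fun f g => SchwartzMap.ext (hadd f g)
        map_smul' := fun a f => SchwartzMap.ext (hsmul a f) } fun i => ?_
    obtain ⟨q, hq, hq0, hle⟩ := hbound i.1 i.2
    exact ⟨q, hq, hq0, fun f => SchwartzMap.seminorm_le_bound ℂ i.1 i.2 _
      ((by positivity : (0 : ℝ) ≤ _).trans (hle f 0)) (hle f)⟩

end Criteria

theorem continuous_schwartz_seminorm {D G : Type*} [NormedAddCommGroup D] [NormedSpace ℝ D]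
    [NormedAddCommGroup G] [NormedSpace ℝ G] (k n : ℕ) :
    Continuous (SchwartzMap.seminorm ℝ k n : 𝓢(D, G) → ℝ) :=
  (schwartz_withSeminorms ℝ D G).continuous_seminorm (k, n)

/-! ### The partial Fourier transform -/

section PartialFourier

variable {V F : Type} [NormedAddCommGroup V] [NormedSpace ℝ V] [NormedAddCommGroup F]
  [NormedSpace ℂ F]

/-- The restriction of a Schwartz function on `V × ℝ` to a line `{x} × ℝ`. -/
def slice (x : V) : 𝓢(V × ℝ, F) →L[ℂ] 𝓢(ℝ, F) :=
  SchwartzMap.compCLM ℂ (g := fun t : ℝ => (x, t))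
    (by
      have : (fun t : ℝ => (x, t)) =
          (fun _ => (x, (0 : ℝ))) + ⇑(ContinuousLinearMap.inr ℝ V ℝ) := by ext <;> simp
      rw [this]
      exact (Function.HasTemperateGrowth.const _).add (ContinuousLinearMap.hasTemperateGrowth _))
    ⟨1, 1, fun t => by
      have : ‖t‖ ≤ ‖(x, t)‖ := norm_snd_le (x, t)
      simp only [one_mul, pow_one]
      linarith⟩

@[simp]
theorem slice_apply (x : V) (Ψ : 𝓢(V × ℝ, F)) (t : ℝ) : slice x Ψ t = Ψ (x, t) := rfl

/-- The Fourier transform in the second variable. -/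
def partialFourier (Ψ : V × ℝ → F) (p : V × ℝ) : F := 𝓕 (fun t => Ψ (p.1, t)) p.2

/-- Two extra powers of the weight buy a majorant that is integrable in t and uniform in x; it
serves both for differentiating under the integral and for bounding the transform. -/
theorem norm_mul_one_add_sq_le (Ψ : 𝓢(V × ℝ, F)) (k : ℕ) (x : V) (t : ℝ) :
    ‖x‖ ^ k * ‖Ψ (x, t)‖ ≤
      (SchwartzMap.seminorm ℝ k 0 Ψ + SchwartzMap.seminorm ℝ (k + 2) 0 Ψ) * (1 + t ^ 2)⁻¹ := by
  have hs : 0 < 1 + t ^ 2 := by positivity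
  rw [← div_eq_mul_inv, le_div_iff₀ hs]
  have h1 := SchwartzMap.norm_pow_mul_le_seminorm ℝ Ψ k (x, t)
  have h2 := SchwartzMap.norm_pow_mul_le_seminorm ℝ Ψ (k + 2) (x, t)
  have hx : ‖x‖ ≤ ‖(x, t)‖ := norm_fst_le (x, t)
  have ht : t ^ 2 ≤ ‖(x, t)‖ ^ 2 := by
    rw [← sq_abs]
    gcongr
    exact norm_snd_le (x, t)
  calc ‖x‖ ^ k * ‖Ψ (x, t)‖ * (1 + t ^ 2)
      ≤ ‖(x, t)‖ ^ k * ‖Ψ (x, t)‖ * (1 + ‖(x, t)‖ ^ 2) := by gcongr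
    _ = ‖(x, t)‖ ^ k * ‖Ψ (x, t)‖ + ‖(x, t)‖ ^ (k + 2) * ‖Ψ (x, t)‖ := by ring
    _ ≤ _ := add_le_add h1 h2

/-- The operator `A` with `D (𝓕₂ Ψ) = 𝓕₂ (A Ψ)`, for the partial Fourier transform `𝓕₂`. -/
def partialFourierDeriv : 𝓢(V × ℝ, F) →L[ℝ] 𝓢(V × ℝ, V × ℝ →L[ℝ] F) :=
  (SchwartzMap.postcompCLM (𝕜 := ℝ) ((ContinuousLinearMap.compL ℝ (V × ℝ) (V × ℝ) F).flip
      ((ContinuousLinearMap.inl ℝ V ℝ).comp (ContinuousLinearMap.fst ℝ V ℝ)))).comp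
    (SchwartzMap.fderivCLM ℝ (V × ℝ) F) +
  (SchwartzMap.smulRightCLM ℝ F ((ContinuousLinearMap.mul ℝ ℝ).bilinearComp
      (ContinuousLinearMap.snd ℝ V ℝ) (ContinuousLinearMap.snd ℝ V ℝ))).comp
    (SchwartzMap.postcompCLM ((-2 * Real.pi * Complex.I : ℂ) • ContinuousLinearMap.id ℝ F))

theorem partialFourierDeriv_apply (Ψ : 𝓢(V × ℝ, F)) (p v : V × ℝ) :
    partialFourierDeriv Ψ p v =
      fderiv ℝ Ψ p (v.1, 0) + (p.2 * v.2) • ((-2 * Real.pi * Complex.I : ℂ) • Ψ p) := by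
  simp [partialFourierDeriv]

theorem integrable_fourierChar_smul (Φ : 𝓢(V × ℝ, F)) (x : V) (w : ℝ) :
    Integrable (fun t : ℝ => (Real.fourierChar (-(t * w)) : ℂ) • Φ (x, t)) := by
  refine ((slice x Φ).integrable (μ := volume)).mono (Continuous.aestronglyMeasurable ?_)
    (Filter.Eventually.of_forall fun t => ?_)
  · exact ((continuous_induced_dom.comp Real.continuous_fourierChar).comp
      (by fun_prop : Continuous fun t : ℝ => -(t * w))).smul (Φ.continuous.comp (by fun_prop))
  · rw [norm_smul, Circle.norm_coe, one_mul, slice_apply]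

theorem hasFDerivAt_fourierChar_smul (Ψ : 𝓢(V × ℝ, F)) (q : V × ℝ) (t : ℝ) : HasFDerivAt
    (fun q : V × ℝ => (Real.fourierChar (-(t * q.2)) : ℂ) • Ψ (q.1, t))
    ((Real.fourierChar (-(t * q.2)) : ℂ) • partialFourierDeriv Ψ (q.1, t)) q := by
  have h1 : HasFDerivAt (fun q : V × ℝ => (Real.fourierChar (-(t * q.2)) : ℂ))
      ((ContinuousLinearMap.snd ℝ V ℝ).smulRight
        ((Real.fourierChar (-(t * q.2)) : ℂ) * (-2 * Real.pi * Complex.I * t))) q := by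
    have h : HasDerivAt (fun w : ℝ => (Real.fourierChar (-(t * w)) : ℂ))
        ((Real.fourierChar (-(t * q.2)) : ℂ) * (-2 * Real.pi * Complex.I * t)) q.2 := by
      have h2 : HasDerivAt (fun w : ℝ => ((2 * Real.pi * -(t * w) : ℝ) : ℂ) * Complex.I)
          (-2 * Real.pi * Complex.I * t) q.2 := by
        have := ((((hasDerivAt_id q.2).const_mul t).neg.const_mul (2 * Real.pi)).ofReal_comp
          ).mul_const Complex.I
        refine (this.congr_deriv (by push_cast; ring)).congr_of_eventuallyEq
          (Filter.Eventually.of_forall fun w => by simp)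
      simpa only [Real.fourierChar_apply] using h2.cexp
    have h3 := h.hasFDerivAt.comp q (hasFDerivAt_snd (𝕜 := ℝ) (p := q))
    exact h3.congr_fderiv (by ext <;> simp)
  have h2 : HasFDerivAt (fun q : V × ℝ => Ψ (q.1, t))
      ((fderiv ℝ Ψ (q.1, t)).comp ((ContinuousLinearMap.inl ℝ V ℝ).comp
        (ContinuousLinearMap.fst ℝ V ℝ))) q := by
    refine (Ψ.hasFDerivAt (q.1, t)).comp q ?_
    exact ((hasFDerivAt_fst (𝕜 := ℝ) (p := q)).prodMk (hasFDerivAt_const t q)).congr_fderiv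
      (by ext <;> simp)
  refine (h1.smul h2).congr_fderiv ?_
  ext v
  · simp [partialFourierDeriv_apply]
  · simp [partialFourierDeriv_apply]
    rw [← Complex.coe_smul, smul_smul, smul_smul]
    ring_nf

/-- Differentiation under the integral. The derivative is again a partial Fourier transform of a
Schwartz function, now with values in a space of linear maps, so smoothness and all bounds follow by
induction with the target space generalized. -/
theorem hasFDerivAt_partialFourier (Ψ : 𝓢(V × ℝ, F)) (p : V × ℝ) :
    HasFDerivAt (partialFourier Ψ) (partialFourier (partialFourierDeriv Ψ) p) p := by
  have h := hasFDerivAt_integral_of_dominated_of_fderiv_le (μ := (volume : Measure ℝ)) (𝕜 := ℝ)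
    (F := fun (q : V × ℝ) t => (Real.fourierChar (-(t * q.2)) : ℂ) • Ψ (q.1, t))
    (F' := fun q t => (Real.fourierChar (-(t * q.2)) : ℂ) • partialFourierDeriv Ψ (q.1, t))
    (x₀ := p) (s := Set.univ) (bound := fun t =>
      (SchwartzMap.seminorm ℝ 0 0 (partialFourierDeriv Ψ) +
        SchwartzMap.seminorm ℝ (0 + 2) 0 (partialFourierDeriv Ψ)) * (1 + t ^ 2)⁻¹)
    Filter.univ_mem
    (Filter.Eventually.of_forall fun q =>
      (integrable_fourierChar_smul Ψ q.1 q.2).aestronglyMeasurable)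
    (integrable_fourierChar_smul Ψ p.1 p.2)
    (integrable_fourierChar_smul _ p.1 p.2).aestronglyMeasurable
    (Filter.Eventually.of_forall fun t q _ => by
      rw [norm_smul, Circle.norm_coe, one_mul]
      simpa using norm_mul_one_add_sq_le (partialFourierDeriv Ψ) 0 q.1 t)
    (integrable_inv_one_add_sq.const_mul _)
    (Filter.Eventually.of_forall fun t q _ => hasFDerivAt_fourierChar_smul Ψ q t)
  unfold partialFourier
  simp only [Real.fourier_real_eq, Circle.smul_def]
  exact h

theorem fderiv_partialFourier (Ψ : 𝓢(V × ℝ, F)) :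
    fderiv ℝ (partialFourier Ψ) = partialFourier (partialFourierDeriv Ψ) :=
  funext fun p => (hasFDerivAt_partialFourier Ψ p).fderiv

theorem contDiff_partialFourier (Ψ : 𝓢(V × ℝ, F)) : ContDiff ℝ ∞ (partialFourier Ψ) := by
  refine contDiff_infty.2 fun n => ?_
  induction n generalizing F with
  | zero =>
    exact contDiff_zero.2 (continuous_iff_continuousAt.2 fun p =>
      (hasFDerivAt_partialFourier Ψ p).continuousAt)
  | succ n ih =>
    rw [Nat.cast_succ]
    refine contDiff_succ_iff_fderiv.2 ⟨fun p =>
      (hasFDerivAt_partialFourier Ψ p).differentiableAt, fun h => ?_, ?_⟩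
    · exact absurd h (by simp)
    rw [fderiv_partialFourier]
    exact ih _

theorem norm_pow_mul_partialFourier_le (Ψ : 𝓢(V × ℝ, F)) (k : ℕ) (p : V × ℝ) :
    ‖p.1‖ ^ k * ‖partialFourier Ψ p‖ ≤
      Real.pi * (SchwartzMap.seminorm ℝ k 0 Ψ + SchwartzMap.seminorm ℝ (k + 2) 0 Ψ) := by
  have h1 : ‖partialFourier Ψ p‖ ≤ ∫ t : ℝ, ‖Ψ (p.1, t)‖ :=
    VectorFourier.norm_fourierIntegral_le_integral_norm _ _ _ _ _
  calc ‖p.1‖ ^ k * ‖partialFourier Ψ p‖ ≤ ‖p.1‖ ^ k * ∫ t : ℝ, ‖Ψ (p.1, t)‖ := by gcongr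
    _ = ∫ t : ℝ, ‖p.1‖ ^ k * ‖Ψ (p.1, t)‖ := (integral_const_mul _ _).symm
    _ ≤ ∫ t : ℝ, (SchwartzMap.seminorm ℝ k 0 Ψ + SchwartzMap.seminorm ℝ (k + 2) 0 Ψ) *
          (1 + t ^ 2)⁻¹ :=
        integral_mono (((slice p.1 Ψ).integrable (μ := volume)).norm.const_mul _)
          (integrable_inv_one_add_sq.const_mul _) fun t => norm_mul_one_add_sq_le Ψ k p.1 t
    _ = _ := by rw [integral_const_mul, integral_univ_inv_one_add_sq, mul_comm]

/-- The derivative in the second variable. -/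
def sndDeriv : 𝓢(V × ℝ, F) →L[ℝ] 𝓢(V × ℝ, F) :=
  (SchwartzMap.evalCLM ℝ (V × ℝ) F ((0 : V), (1 : ℝ))).comp (SchwartzMap.fderivCLM ℝ (V × ℝ) F)

theorem deriv_slice (Ψ : 𝓢(V × ℝ, F)) (x : V) (t : ℝ) :
    deriv (slice x Ψ) t = sndDeriv Ψ (x, t) := by
  have h : HasDerivAt (fun s : ℝ => (x, s)) ((0 : V), (1 : ℝ)) t :=
    (hasDerivAt_const t x).prodMk (hasDerivAt_id t)
  exact ((Ψ.hasFDerivAt (x, t)).comp_hasDerivAt t h).deriv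

theorem partialFourier_sndDeriv (Ψ : 𝓢(V × ℝ, F)) (p : V × ℝ) :
    partialFourier (sndDeriv Ψ) p = (2 * Real.pi * Complex.I * p.2) • partialFourier Ψ p := by
  have h := Real.fourier_deriv (f := slice p.1 Ψ) ((slice p.1 Ψ).integrable)
    (slice p.1 Ψ).differentiable
    ((SchwartzMap.derivCLM ℝ F (slice p.1 Ψ)).integrable)
  have h2 : deriv (slice p.1 Ψ) = fun t => sndDeriv Ψ (p.1, t) := funext fun t => deriv_slice Ψ _ t
  rw [h2] at h
  exact congrFun h p.2

/-- Each power of the frequency is traded for a derivative in the second variable; the factor 2π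
gained is at least 1 and is discarded. -/
theorem exists_abs_pow_mul_partialFourier_le (k : ℕ) : ∃ q : 𝓢(V × ℝ, F) → ℝ, Continuous q ∧
    q 0 = 0 ∧ ∀ (Ψ : 𝓢(V × ℝ, F)) (p : V × ℝ), |p.2| ^ k * ‖partialFourier Ψ p‖ ≤ q Ψ := by
  induction k with
  | zero =>
    refine ⟨fun Ψ => Real.pi * (SchwartzMap.seminorm ℝ 0 0 Ψ + SchwartzMap.seminorm ℝ (0 + 2) 0 Ψ),
      ((continuous_schwartz_seminorm _ _).add (continuous_schwartz_seminorm _ _)).const_mul _,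
      by simp, fun Ψ p => by simpa using norm_pow_mul_partialFourier_le Ψ 0 p⟩
  | succ k ih =>
    obtain ⟨q, hq, hq0, hle⟩ := ih
    refine ⟨fun Ψ => q (sndDeriv Ψ), hq.comp sndDeriv.continuous, by simp [hq0],
      fun Ψ p => (le_trans ?_ (hle (sndDeriv Ψ) p))⟩
    rw [partialFourier_sndDeriv, norm_smul, pow_succ, mul_assoc]
    gcongr
    simp only [Complex.norm_mul, Complex.norm_ofNat, Complex.norm_real, Real.norm_eq_abs,
      Complex.norm_I, mul_one, abs_of_pos Real.pi_pos]
    have := Real.two_le_pi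
    nlinarith [abs_nonneg p.2]

theorem exists_partialFourier_le (k n : ℕ) : ∃ q : 𝓢(V × ℝ, F) → ℝ, Continuous q ∧ q 0 = 0 ∧
    ∀ (Ψ : 𝓢(V × ℝ, F)) (p : V × ℝ), ‖p‖ ^ k * ‖iteratedFDeriv ℝ n (partialFourier Ψ) p‖ ≤ q Ψ := by
  induction n generalizing F with
  | zero =>
    obtain ⟨q, hq, hq0, hle⟩ := exists_abs_pow_mul_partialFourier_le (V := V) (F := F) k
    refine ⟨fun Ψ => Real.pi * (SchwartzMap.seminorm ℝ k 0 Ψ + SchwartzMap.seminorm ℝ (k + 2) 0 Ψ)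
      + q Ψ, (((continuous_schwartz_seminorm _ _).add
        (continuous_schwartz_seminorm _ _)).const_mul _).add hq, by simp [hq0], fun Ψ p => ?_⟩
    rw [norm_iteratedFDeriv_zero]
    refine le_trans ?_ (add_le_add (norm_pow_mul_partialFourier_le Ψ k p) (hle Ψ p))
    rw [← add_mul]
    gcongr
    rcases max_cases ‖p.1‖ ‖p.2‖ with h | h
    · rw [Prod.norm_def, h.1]
      have : 0 ≤ |p.2| ^ k := by positivity
      linarith
    · rw [Prod.norm_def, h.1, Real.norm_eq_abs]
      have : 0 ≤ ‖p.1‖ ^ k := by positivity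
      linarith
  | succ n ih =>
    obtain ⟨q, hq, hq0, hle⟩ := ih (F := V × ℝ →L[ℝ] F)
    refine ⟨fun Ψ => q (partialFourierDeriv Ψ), hq.comp partialFourierDeriv.continuous,
      by simp [hq0], fun Ψ p => ?_⟩
    rw [← norm_iteratedFDeriv_fderiv, fderiv_partialFourier]
    exact hle _ p

/-- The Fourier transform in the second variable, as an operator on Schwartz functions. -/
def partialFourierCLM : 𝓢(V × ℝ, F) →L[ℂ] 𝓢(V × ℝ, F) :=
  schwartzCLM (fun Ψ => partialFourier Ψ)
    (fun Ψ Φ p => by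
      simp only [partialFourier, Real.fourier_real_eq, Circle.smul_def, add_apply, smul_add]
      exact integral_add (integrable_fourierChar_smul Ψ p.1 p.2)
        (integrable_fourierChar_smul Φ p.1 p.2))
    (fun a Ψ p => by
      simp only [partialFourier, Real.fourier_real_eq, Circle.smul_def, smul_apply]
      rw [← integral_smul]
      exact integral_congr_ae (Filter.Eventually.of_forall fun t => smul_comm _ _ _))
    contDiff_partialFourier exists_partialFourier_le

theorem partialFourierCLM_apply (Ψ : 𝓢(V × ℝ, F)) (p : V × ℝ) :
    partialFourierCLM Ψ p = 𝓕 (fun t => Ψ (p.1, t)) p.2 := rfl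

end PartialFourier

/-! ### Flat functions -/

/-- The function `f` on `V × ℝ` vanishes to infinite order on `V × {0}`. -/
def IsFlat {V F : Type*} [NormedAddCommGroup V] [NormedSpace ℝ V] [NormedAddCommGroup F]
    [NormedSpace ℝ F] (f : V × ℝ → F) : Prop :=
  ∀ (m : ℕ) (x : V), iteratedFDeriv ℝ m f (x, 0) = 0

section Flat

variable {V F : Type} [NormedAddCommGroup V] [NormedSpace ℝ V] [NormedAddCommGroup F]

theorem IsFlat.apply_zero [NormedSpace ℝ F] {f : V × ℝ → F} (hf : IsFlat f) (x : V) :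
    f (x, 0) = 0 := by
  simpa using congrArg norm (hf 0 x)

theorem isFlat_fderiv [NormedSpace ℝ F] {f : V × ℝ → F} (hf : IsFlat f) :
    IsFlat (fderiv ℝ f) := fun m x => by
  rw [← norm_eq_zero, norm_iteratedFDeriv_fderiv, hf, norm_zero]

theorem IsFlat.sub [NormedSpace ℝ F] {f g : V × ℝ → F} (hf : IsFlat f) (hg : IsFlat g)
    (hfs : ContDiff ℝ ∞ f) (hgs : ContDiff ℝ ∞ g) : IsFlat (f - g) := fun m x => by
  rw [iteratedFDeriv_sub_apply (hfs.contDiffAt.of_le (by exact_mod_cast le_top))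
    (hgs.contDiffAt.of_le (by exact_mod_cast le_top)), hf, hg, sub_zero]

theorem IsFlat.bilin [NormedSpace ℝ F] {G H : Type} [NormedAddCommGroup G] [NormedSpace ℝ G]
    [NormedAddCommGroup H] [NormedSpace ℝ H] (B : F →L[ℝ] G →L[ℝ] H) {f : V × ℝ → F}
    {g : V × ℝ → G} (hf : IsFlat f) (hfs : ContDiff ℝ ∞ f) (hgs : ContDiff ℝ ∞ g) :
    IsFlat fun p => B (f p) (g p) := fun m x => by
  rw [← norm_le_zero_iff]
  refine (B.norm_iteratedFDeriv_le_of_bilinear hfs hgs (x, 0) (n := m)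
    (by exact_mod_cast le_top)).trans_eq ?_
  rw [Finset.sum_eq_zero (fun i _ => by rw [hf i x, norm_zero]; ring), mul_zero]

/-- All moments in the second variable vanish. -/
def HasZeroMoments [NormedSpace ℝ F] (f : V × ℝ → F) : Prop :=
  ∀ (k : ℕ) (x : V), ∫ t : ℝ, t ^ k • f (x, t) = 0

theorem hasTemperateGrowth_snd_pow (k : ℕ) : Function.HasTemperateGrowth
    (fun p : V × ℝ => p.2 ^ k) :=
  (ContinuousLinearMap.snd ℝ V ℝ).hasTemperateGrowth.pow k

/-- The operator consists of a derivative in x, under which an identically vanishing moment stays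
zero, and a multiplication by t, which only shifts the order of the moment. -/
theorem hasZeroMoments_partialFourierDeriv [NormedSpace ℂ F] {Ψ : 𝓢(V × ℝ, F)}
    (h : HasZeroMoments Ψ) : HasZeroMoments (partialFourierDeriv Ψ) := by
  intro k x
  have hP : ∀ (m : ℕ) (p : V × ℝ), SchwartzMap.smulLeftCLM F (fun p : V × ℝ => p.2 ^ m) Ψ p =
      p.2 ^ m • Ψ p := fun m p =>
    SchwartzMap.smulLeftCLM_apply_apply (hasTemperateGrowth_snd_pow m) Ψ p
  -- The k-th moment of Ψ is the partial Fourier transform of Φ at frequency 0, so the derivative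
  -- formula already proved supplies the exchange of ∂_x with the integral.
  set Φ := SchwartzMap.smulLeftCLM F (fun p : V × ℝ => p.2 ^ k) Ψ with hΦ
  have hA : ∀ (Θ : 𝓢(V × ℝ, F)) (y : V), Integrable fun t : ℝ =>
      partialFourierDeriv Θ (y, t) := fun Θ y =>
    (slice y (partialFourierDeriv Θ)).integrable
  have h0 : ∀ y, partialFourier Φ (y, 0) = 0 := fun y => by
    simpa [partialFourier, Real.fourier_real_eq, hΦ, hP] using h k y
  have hx : ∀ v : V, ∫ t : ℝ, t ^ k • fderiv ℝ Ψ (x, t) (v, 0) = 0 := by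
    intro v
    have h2 : HasFDerivAt (fun y : V => (y, (0 : ℝ)))
        ((ContinuousLinearMap.id ℝ V).prod (0 : V →L[ℝ] ℝ)) x :=
      (hasFDerivAt_id x).prodMk (hasFDerivAt_const (0 : ℝ) x)
    have h1 := HasFDerivAt.comp x (hasFDerivAt_partialFourier Φ (x, 0)) h2
    rw [show partialFourier Φ ∘ (fun y : V => (y, (0 : ℝ))) = fun _ => 0 from funext h0] at h1
    have h3 := congrArg (fun L : V →L[ℝ] F => L v) (h1.unique (hasFDerivAt_const (0 : F) x))
    simp only [partialFourier, Real.fourier_real_eq, mul_zero, neg_zero, AddChar.map_zero_eq_one,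
      one_smul] at h3
    have h4 : (∫ t : ℝ, partialFourierDeriv Φ (x, t)) (v, 0) = 0 := by
      simpa using h3
    rw [ContinuousLinearMap.integral_apply (hA Φ x)] at h4
    rw [← h4]
    congr 1
    funext t
    rw [partialFourierDeriv_apply]
    have h5 : HasFDerivAt (fun p : V × ℝ => p.2 ^ k • Ψ p) _ (x, t) :=
      ((hasFDerivAt_snd (𝕜 := ℝ) (p := (x, t))).pow k).smul (Ψ.hasFDerivAt (x, t))
    have h6 : (Φ : V × ℝ → F) = fun p => p.2 ^ k • Ψ p := funext (hP k)
    rw [h6, h5.fderiv]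
    simp
  have hi : Integrable fun t : ℝ => t ^ k • partialFourierDeriv Ψ (x, t) := by
    have := (slice x (SchwartzMap.smulLeftCLM (V × ℝ →L[ℝ] F) (fun p : V × ℝ => p.2 ^ k)
      (partialFourierDeriv Ψ))).integrable (μ := volume)
    refine this.congr (Filter.Eventually.of_forall fun t => ?_)
    simp [SchwartzMap.smulLeftCLM_apply_apply (hasTemperateGrowth_snd_pow k)]
  refine ContinuousLinearMap.ext fun v => ?_
  rw [ContinuousLinearMap.integral_apply hi, zero_apply]
  have e : ∀ t : ℝ, (t ^ k • partialFourierDeriv Ψ (x, t)) v =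
      t ^ k • fderiv ℝ Ψ (x, t) (v.1, 0) +
        (v.2 • (-2 * Real.pi * Complex.I : ℂ)) • (t ^ (k + 1) • Ψ (x, t)) := fun t => by
    rw [smul_apply, partialFourierDeriv_apply, smul_add]
    congr 1
    rw [smul_assoc, smul_comm v.2 (-2 * Real.pi * Complex.I : ℂ),
      smul_comm (t * v.2) (-2 * Real.pi * Complex.I : ℂ),
      smul_comm (t ^ k) (-2 * Real.pi * Complex.I : ℂ), smul_smul, smul_smul]
    ring_nf
  simp only [e]
  rw [integral_add, integral_smul, hx v.1, h (k + 1) x, smul_zero, add_zero]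
  · have := (slice x (SchwartzMap.smulLeftCLM F (fun p : V × ℝ => p.2 ^ k)
      (SchwartzMap.evalCLM ℝ (V × ℝ) F (v.1, (0 : ℝ)) (SchwartzMap.fderivCLM ℝ (V × ℝ) F Ψ)))
      ).integrable (μ := volume)
    refine this.congr (Filter.Eventually.of_forall fun t => ?_)
    simp [SchwartzMap.smulLeftCLM_apply_apply (hasTemperateGrowth_snd_pow k)]
  · refine Integrable.smul _ ?_
    have := (slice x (SchwartzMap.smulLeftCLM F (fun p : V × ℝ => p.2 ^ (k + 1)) Ψ)
      ).integrable (μ := volume)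
    refine this.congr (Filter.Eventually.of_forall fun t => ?_)
    simp [SchwartzMap.smulLeftCLM_apply_apply (hasTemperateGrowth_snd_pow (k + 1))]

/-- At frequency 0 the transform is the zeroth moment, and vanishing moments survive the
differentiation rule. -/
theorem HasZeroMoments.isFlat_partialFourier [NormedSpace ℂ F] {Ψ : 𝓢(V × ℝ, F)}
    (h : HasZeroMoments Ψ) : IsFlat (partialFourier Ψ) := by
  intro m x
  rw [← norm_eq_zero]
  induction m generalizing F with
  | zero => simpa [partialFourier, Real.fourier_real_eq] using h 0 x
  | succ m ih =>
    rw [← norm_iteratedFDeriv_fderiv, fderiv_partialFourier]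
    exact ih (hasZeroMoments_partialFourierDeriv h)

variable [NormedSpace ℝ F]

theorem seminorm_fderivCLM_le (Ψ : 𝓢(V × ℝ, F)) (k n : ℕ) :
    SchwartzMap.seminorm ℝ k n (SchwartzMap.fderivCLM ℝ (V × ℝ) F Ψ) ≤
      SchwartzMap.seminorm ℝ k (n + 1) Ψ := by
  refine SchwartzMap.seminorm_le_bound ℝ k n _ (apply_nonneg _ _) fun p => ?_
  have : (SchwartzMap.fderivCLM ℝ (V × ℝ) F Ψ : V × ℝ → _) = fderiv ℝ Ψ := rfl
  rw [this, norm_iteratedFDeriv_fderiv]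
  exact SchwartzMap.le_seminorm ℝ k (n + 1) Ψ p

/-- The mean value inequality on {x} × [-|t|, |t|], applied to successive derivatives, stands in for
Taylor's formula. -/
theorem IsFlat.norm_le {Ψ : 𝓢(V × ℝ, F)} (h : IsFlat Ψ) (n : ℕ) (x : V) (t : ℝ) :
    ‖Ψ (x, t)‖ ≤ |t| ^ n * SchwartzMap.seminorm ℝ 0 n Ψ := by
  induction n generalizing F t with
  | zero => simpa using SchwartzMap.norm_le_seminorm ℝ Ψ (x, t)
  | succ n ih =>
    have h' : IsFlat (SchwartzMap.fderivCLM ℝ (V × ℝ) F Ψ) := isFlat_fderiv h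
    have hb : ∀ p ∈ ({x} ×ˢ Metric.closedBall 0 |t| : Set (V × ℝ)),
        ‖fderiv ℝ Ψ p‖ ≤ |t| ^ n * SchwartzMap.seminorm ℝ 0 (n + 1) Ψ := by
      rintro ⟨y, s⟩ ⟨hy, hs⟩
      obtain rfl : y = x := hy
      have hs' : |s| ≤ |t| := by simpa using hs
      refine (ih h' s).trans ?_
      have := seminorm_fderivCLM_le Ψ 0 n
      have h0 : 0 ≤ SchwartzMap.seminorm ℝ 0 n (SchwartzMap.fderivCLM ℝ (V × ℝ) F Ψ) :=
        apply_nonneg _ _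
      gcongr
    have := Convex.norm_image_sub_le_of_norm_fderiv_le (x := (x, (0 : ℝ))) (y := (x, t))
      (fun p _ => Ψ.differentiableAt) hb ((convex_singleton x).prod (convex_closedBall 0 |t|))
      (by simp) (by simp)
    rw [h.apply_zero, sub_zero] at this
    refine this.trans_eq ?_
    simp
    ring

end Flat

/-! ### Functions in polar coordinates -/

section Polar

variable {V F : Type} [NormedAddCommGroup V] [InnerProductSpace ℝ V] [NormedAddCommGroup F]
  [NormedSpace ℝ F]

/-- The function `|x|⁻ʲ Ψ (x / |x|, |x|)`. -/
def polarPull (j : ℕ) (Ψ : V × ℝ → F) (x : V) : F := (‖x‖⁻¹) ^ j • Ψ (‖x‖⁻¹ • x, ‖x‖)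

theorem hasTemperateGrowth_polarDeriv_aux : Function.HasTemperateGrowth (fun p : V × ℝ =>
    ContinuousLinearMap.inl ℝ V ℝ - ContinuousLinearMap.smulRightL ℝ V (V × ℝ)
      (innerSL ℝ p.1) (p.1, -p.2)) := by
  refine (Function.HasTemperateGrowth.const _).sub ?_
  refine ContinuousLinearMap.bilinear_hasTemperateGrowth _ ?_ ?_
  · exact ((innerSL ℝ).comp (ContinuousLinearMap.fst ℝ V ℝ)).hasTemperateGrowth
  · exact ((ContinuousLinearMap.fst ℝ V ℝ).prod
      (-ContinuousLinearMap.snd ℝ V ℝ)).hasTemperateGrowth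

/-- The operator `A` with `D (polarPull j Ψ) = polarPull (j + 1) (A Ψ)`. -/
def polarDeriv (j : ℕ) : 𝓢(V × ℝ, F) →L[ℝ] 𝓢(V × ℝ, V →L[ℝ] F) :=
  (SchwartzMap.bilinLeftCLM (ContinuousLinearMap.compL ℝ V (V × ℝ) F)
    hasTemperateGrowth_polarDeriv_aux).comp (SchwartzMap.fderivCLM ℝ (V × ℝ) F) -
  (j : ℝ) • SchwartzMap.smulRightCLM ℝ F ((innerSL ℝ).comp (ContinuousLinearMap.fst ℝ V ℝ))

theorem polarDeriv_apply (j : ℕ) (Ψ : 𝓢(V × ℝ, F)) (p : V × ℝ) (v : V) :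
    polarDeriv j Ψ p v = fderiv ℝ Ψ p ((v, 0) - inner ℝ p.1 v • (p.1, -p.2)) -
      (j : ℝ) • (inner ℝ p.1 v : ℝ) • Ψ p := by
  have : (ContinuousLinearMap.smulRightL ℝ V (V × ℝ) (innerSL ℝ p.1) (p.1, -p.2)) v =
    inner ℝ p.1 v • (p.1, -p.2) := rfl
  simp only [polarDeriv, sub_apply, smul_apply, ContinuousLinearMap.comp_apply,
    SchwartzMap.bilinLeftCLM_apply, ContinuousLinearMap.compL_apply, this]
  rfl

theorem isFlat_polarDeriv {Ψ : 𝓢(V × ℝ, F)} (h : IsFlat Ψ) (j : ℕ) :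
    IsFlat (polarDeriv j Ψ) := by
  have hs : ContDiff ℝ ∞ Ψ := Ψ.smooth ⊤
  have h1 := (isFlat_fderiv h).bilin (ContinuousLinearMap.compL ℝ V (V × ℝ) F)
    ((SchwartzMap.fderivCLM ℝ (V × ℝ) F Ψ).smooth ⊤)
    (hasTemperateGrowth_polarDeriv_aux (V := V)).1
  have h2 := h.bilin ((j : ℝ) • (ContinuousLinearMap.smulRightL ℝ V F).flip) hs
    ((innerSL ℝ).comp (ContinuousLinearMap.fst ℝ V ℝ)).contDiff
  refine h1.sub h2 ?_ ?_
  · exact (SchwartzMap.bilinLeftCLM (ContinuousLinearMap.compL ℝ V (V × ℝ) F)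
      hasTemperateGrowth_polarDeriv_aux (SchwartzMap.fderivCLM ℝ (V × ℝ) F Ψ)).smooth ⊤
  · exact ((j : ℝ) • SchwartzMap.smulRightCLM ℝ F
      ((innerSL ℝ).comp (ContinuousLinearMap.fst ℝ V ℝ)) Ψ).smooth ⊤

theorem polarPull_zero {Ψ : 𝓢(V × ℝ, F)} (h : IsFlat Ψ) (j : ℕ) : polarPull j Ψ 0 = 0 := by
  simp [polarPull, h.apply_zero]

/-- Truncated subtraction merges two cases: for j ≤ k a positive power of |x| remains and decay
bounds it, for k ≤ j a negative power remains and flatness of order j - k bounds it. -/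
theorem norm_polarPull_le {Ψ : 𝓢(V × ℝ, F)} (h : IsFlat Ψ) (j k : ℕ) (x : V) :
    ‖x‖ ^ k * ‖polarPull j Ψ x‖ ≤ SchwartzMap.seminorm ℝ (k - j) (j - k) Ψ := by
  rcases eq_or_ne x 0 with rfl | hx
  · rw [polarPull_zero h, norm_zero (E := F), mul_zero]
    exact apply_nonneg _ _
  have hr : 0 < ‖x‖ := norm_pos_iff.2 hx
  rw [polarPull, norm_smul, norm_pow, norm_inv, norm_norm, inv_pow, ← mul_assoc]
  rcases le_total j k with hjk | hjk
  · rw [Nat.sub_eq_zero_of_le hjk, ← pow_sub₀ _ hr.ne' hjk]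
    refine le_trans ?_ (SchwartzMap.norm_pow_mul_le_seminorm ℝ Ψ (k - j) (‖x‖⁻¹ • x, ‖x‖))
    gcongr
    simp
  · rw [Nat.sub_eq_zero_of_le hjk]
    have := h.norm_le (j - k) (‖x‖⁻¹ • x) ‖x‖
    rw [abs_norm] at this
    calc ‖x‖ ^ k * (‖x‖ ^ j)⁻¹ * ‖Ψ (‖x‖⁻¹ • x, ‖x‖)‖
        ≤ ‖x‖ ^ k * (‖x‖ ^ j)⁻¹ * (‖x‖ ^ (j - k) * SchwartzMap.seminorm ℝ 0 (j - k) Ψ) := by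
          gcongr
      _ = (‖x‖ ^ (j - k) * ‖x‖ ^ k) * (‖x‖ ^ j)⁻¹ * SchwartzMap.seminorm ℝ 0 (j - k) Ψ := by ring
      _ = _ := by
        rw [← pow_add, Nat.sub_add_cancel hjk, mul_inv_cancel₀ (by positivity), one_mul]

theorem hasFDerivAt_norm_of_ne {x : V} (hx : x ≠ 0) :
    HasFDerivAt (fun y : V => ‖y‖) (‖x‖⁻¹ • innerSL ℝ x) x := by
  have h := ((hasStrictFDerivAt_norm_sq x).hasFDerivAt).sqrt (by simpa using hx)
  simp only [Real.sqrt_sq (norm_nonneg _)] at h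
  refine h.congr_fderiv ?_
  ext v
  simp
  ring

/-- Away from the origin this is the product and chain rule, at the cost of one more factor 1/|x|.
At the origin flatness of order j + 2 makes the function O(|x|²), so its derivative is zero. Since
flatness is inherited by `polarDeriv`, the rule iterates. -/
theorem hasFDerivAt_polarPull {Ψ : 𝓢(V × ℝ, F)} (h : IsFlat Ψ) (j : ℕ) (x : V) :
    HasFDerivAt (polarPull j Ψ) (polarPull (j + 1) (polarDeriv j Ψ) x) x := by
  rcases eq_or_ne x 0 with rfl | hx
  · rw [polarPull_zero (isFlat_polarDeriv h j), hasFDerivAt_iff_isLittleO_nhds_zero]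
    simp only [zero_add, polarPull_zero h, sub_zero, zero_apply]
    have hO : (fun y => polarPull j Ψ y) =O[nhds 0] fun y : V => ‖y‖ ^ 2 := by
      refine Asymptotics.IsBigO.of_bound (SchwartzMap.seminorm ℝ 0 (j + 2) Ψ)
        (Filter.Eventually.of_forall fun y => ?_)
      rcases eq_or_ne y 0 with rfl | hy
      · simp [polarPull_zero h]
      have hr : 0 < ‖y‖ := norm_pos_iff.2 hy
      have := h.norm_le (j + 2) (‖y‖⁻¹ • y) ‖y‖
      rw [abs_norm] at this
      rw [polarPull, norm_smul, norm_pow, norm_inv, norm_norm, norm_pow, norm_norm, inv_pow,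
        inv_mul_le_iff₀ (by positivity)]
      refine this.trans_eq ?_
      ring
    refine hO.trans_isLittleO ?_
    exact Asymptotics.isLittleO_norm_right.1
      ((Asymptotics.isLittleO_pow_id (𝕜 := ℝ) one_lt_two).comp_tendsto
        (tendsto_norm_zero (E := V)))
  · have hr : 0 < ‖x‖ := norm_pos_iff.2 hx
    have hn := hasFDerivAt_norm_of_ne hx
    have hi : HasFDerivAt (fun y : V => ‖y‖⁻¹) _ x :=
      (hasDerivAt_inv hr.ne').comp_hasFDerivAt x hn
    have h1 := ((hi.pow j).smul ((Ψ.hasFDerivAt (‖x‖⁻¹ • x, ‖x‖)).comp x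
      ((hi.smul (hasFDerivAt_id x)).prodMk hn)))
    refine h1.congr_fderiv ?_
    ext v
    have e1 : (‖x‖⁻¹ • v + -(((‖x‖ ^ 2)⁻¹ * (‖x‖⁻¹ * inner ℝ x v)) • x), ‖x‖⁻¹ * inner ℝ x v) =
        ‖x‖⁻¹ • (v - inner ℝ (‖x‖⁻¹ • x) v • ‖x‖⁻¹ • x, inner ℝ (‖x‖⁻¹ • x) v * ‖x‖) := by
      rw [real_inner_smul_left, Prod.smul_mk]
      congr 1
      · rw [smul_sub, smul_smul, smul_smul, ← sub_eq_add_neg]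
        congr 2
        ring
      · rw [smul_eq_mul]
        field_simp
    have e2 : (j : ℝ) * (‖x‖ ^ (j - 1))⁻¹ * ((‖x‖ ^ 2)⁻¹ * (‖x‖⁻¹ * inner ℝ x v)) =
        (‖x‖ ^ (j + 1))⁻¹ * (j * inner ℝ (‖x‖⁻¹ • x) v) := by
      rw [real_inner_smul_left]
      -- For j = 0 the truncated exponent j - 1 is harmless, because the factor j vanishes.
      rcases j with _ | j
      · simp
      · simp only [Nat.add_sub_cancel]
        field_simp
        ring
    simp [polarPull, polarDeriv_apply]
    rw [e1, e2, map_smul, smul_sub, ← sub_eq_add_neg, smul_smul _ ‖x‖⁻¹, smul_smul (j : ℝ),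
      smul_smul _ ((j : ℝ) * _), pow_succ, mul_inv]

theorem contDiff_polarPull {Ψ : 𝓢(V × ℝ, F)} (h : IsFlat Ψ) (j : ℕ) :
    ContDiff ℝ ∞ (polarPull j Ψ) := by
  refine contDiff_infty.2 fun n => ?_
  induction n generalizing F j with
  | zero =>
    exact contDiff_zero.2 (continuous_iff_continuousAt.2 fun p =>
      (hasFDerivAt_polarPull h j p).continuousAt)
  | succ n ih =>
    rw [Nat.cast_succ]
    refine contDiff_succ_iff_fderiv.2 ⟨fun p =>
      (hasFDerivAt_polarPull h j p).differentiableAt, fun h => ?_, ?_⟩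
    · exact absurd h (by simp)
    · rw [show fderiv ℝ (polarPull j Ψ) = polarPull (j + 1) (polarDeriv j Ψ) from
        funext fun p => (hasFDerivAt_polarPull h j p).fderiv]
      exact ih (isFlat_polarDeriv h j) _

theorem exists_polarPull_le (j k n : ℕ) : ∃ q : 𝓢(V × ℝ, F) → ℝ, Continuous q ∧ q 0 = 0 ∧
    ∀ Ψ : 𝓢(V × ℝ, F), IsFlat Ψ → ∀ x : V,
      ‖x‖ ^ k * ‖iteratedFDeriv ℝ n (polarPull j Ψ) x‖ ≤ q Ψ := by
  induction n generalizing F j with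
  | zero =>
    exact ⟨SchwartzMap.seminorm ℝ (k - j) (j - k), continuous_schwartz_seminorm _ _, map_zero _,
      fun Ψ h x => by simpa only [norm_iteratedFDeriv_zero] using norm_polarPull_le h j k x⟩
  | succ n ih =>
    obtain ⟨q, hq, hq0, hle⟩ := ih (F := V →L[ℝ] F) (j + 1)
    refine ⟨fun Ψ => q (polarDeriv j Ψ), hq.comp (polarDeriv j).continuous, by simp [hq0],
      fun Ψ h x => ?_⟩
    rw [← norm_iteratedFDeriv_fderiv, show fderiv ℝ (polarPull j Ψ) =
      polarPull (j + 1) (polarDeriv j Ψ) from funext fun p => (hasFDerivAt_polarPull h j p).fderiv]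
    exact hle _ (isFlat_polarDeriv h j) x

end Polar

/-! ### Cutting off near the sphere -/

section Cutoff

variable {V F : Type} [NormedAddCommGroup V] [InnerProductSpace ℝ V] [NormedAddCommGroup F]
  [NormedSpace ℝ F]

/-- A smooth bump function on `ℝ` around `1`. -/
def bumpAtOne : ContDiffBump (1 : ℝ) := ⟨1 / 4, 1 / 2, by norm_num, by norm_num⟩

/-- A smooth function supported in an annulus and equal to `1` near the unit sphere. -/
def annulusBump (x : V) : ℝ := bumpAtOne (‖x‖ ^ 2)

/-- The set `1/2 ≤ |x|² ≤ 3/2`. -/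
def annulus (V : Type) [NormedAddCommGroup V] : Set V := {x | 1 / 2 ≤ ‖x‖ ^ 2 ∧ ‖x‖ ^ 2 ≤ 3 / 2}

theorem contDiff_annulusBump : ContDiff ℝ ∞ (annulusBump : V → ℝ) :=
  (bumpAtOne.contDiff (n := ⊤)).comp (contDiff_norm_sq ℝ)

theorem isClosed_annulus {V : Type} [NormedAddCommGroup V] : IsClosed (annulus V) := by
  have h : Continuous fun x : V => ‖x‖ ^ 2 := by fun_prop
  exact (isClosed_le continuous_const h).inter (isClosed_le h continuous_const)

theorem annulusBump_of_notMem {V : Type} [NormedAddCommGroup V] {x : V} (hx : x ∉ annulus V) :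
    annulusBump x = 0 := by
  refine bumpAtOne.zero_of_le_dist ?_
  change 1 / 2 ≤ |‖x‖ ^ 2 - 1|
  rw [annulus, Set.mem_ofPred_eq, not_and_or, not_le, not_le] at hx
  rcases hx with hx | hx
  · rw [abs_sub_comm]
    exact le_trans (by linarith) (le_abs_self _)
  · exact le_trans (by linarith) (le_abs_self _)

theorem ne_zero_of_mem_annulus {V : Type} [NormedAddCommGroup V] {x : V} (hx : x ∈ annulus V) :
    x ≠ 0 := by
  rintro rfl
  have := hx.1
  norm_num at this

theorem norm_le_of_mem_annulus {V : Type} [NormedAddCommGroup V] {x : V} (hx : x ∈ annulus V) :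
    ‖x‖ ≤ 2 := by
  nlinarith [hx.2, norm_nonneg x]

theorem inv_norm_le_of_mem_annulus {V : Type} [NormedAddCommGroup V] {x : V} (hx : x ∈ annulus V) :
    ‖x‖⁻¹ ≤ 2 := by
  have h0 : 0 < ‖x‖ := norm_pos_iff.2 (ne_zero_of_mem_annulus hx)
  rw [inv_le_comm₀ h0 two_pos]
  nlinarith [hx.1]

theorem annulusBump_eventuallyEq {V : Type} [NormedAddCommGroup V] {x : V} (hx : ‖x‖ = 1) :
    (annulusBump : V → ℝ) =ᶠ[nhds x] fun _ => 1 := by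
  have h : Filter.Tendsto (fun y : V => ‖y‖ ^ 2) (nhds x) (nhds 1) := by
    have : Continuous fun y : V => ‖y‖ ^ 2 := by fun_prop
    simpa [hx] using this.tendsto x
  exact h.eventually bumpAtOne.eventuallyEq_one

theorem hasCompactSupport_annulusBump {V : Type} [NormedAddCommGroup V] [ProperSpace V] :
    HasCompactSupport (annulusBump : V → ℝ) := by
  refine HasCompactSupport.intro (isCompact_closedBall (0 : V) 2) fun x hx => ?_
  refine annulusBump_of_notMem fun h => hx ?_
  simpa using norm_le_of_mem_annulus h

theorem iteratedFDeriv_cutoff_of_notMem (f : V × ℝ → F) (n : ℕ) {p : V × ℝ}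
    (hp : p.1 ∉ annulus V) : iteratedFDeriv ℝ n (fun q => annulusBump q.1 • f q) p = 0 := by
  have h : (fun q : V × ℝ => annulusBump q.1 • f q) =ᶠ[nhds p] fun _ => 0 := by
    have : {q : V × ℝ | q.1 ∉ annulus V} ∈ nhds p :=
      (isClosed_annulus.isOpen_compl.preimage continuous_fst).mem_nhds hp
    filter_upwards [this] with q hq
    rw [annulusBump_of_notMem hq, zero_smul]
  rw [(h.iteratedFDeriv ℝ n).eq_of_nhds]
  simp

theorem isOpen_fst_ne_zero {V : Type} [NormedAddCommGroup V] : IsOpen {p : V × ℝ | p.1 ≠ 0} :=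
  isOpen_ne.preimage continuous_fst

theorem contDiff_cutoff {f : V × ℝ → F} (hf : ContDiffOn ℝ ∞ f {p | p.1 ≠ 0}) :
    ContDiff ℝ ∞ fun p => annulusBump p.1 • f p := by
  refine contDiff_iff_contDiffAt.2 fun p => ?_
  by_cases hp : p.1 ∈ annulus V
  · exact (contDiff_annulusBump.contDiffAt.comp p contDiffAt_fst).smul
      (hf.contDiffAt (isOpen_fst_ne_zero.mem_nhds (ne_zero_of_mem_annulus hp)))
  · have h : (fun q : V × ℝ => annulusBump q.1 • f q) =ᶠ[nhds p] fun _ => 0 := by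
      have : {q : V × ℝ | q.1 ∉ annulus V} ∈ nhds p :=
        (isClosed_annulus.isOpen_compl.preimage continuous_fst).mem_nhds hp
      filter_upwards [this] with q hq
      rw [annulusBump_of_notMem hq, zero_smul]
    exact contDiffAt_const.congr_of_eventuallyEq h

theorem exists_norm_iteratedFDeriv_annulusBump_le [ProperSpace V] (n : ℕ) : ∃ C : ℝ, 0 ≤ C ∧
    ∀ p : V × ℝ, ‖iteratedFDeriv ℝ n (fun q : V × ℝ => annulusBump q.1) p‖ ≤ C := by
  obtain ⟨C, hC⟩ := ((contDiff_annulusBump (V := V)).continuous_iteratedFDeriv (m := n)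
    (by exact_mod_cast le_top)).bounded_above_of_compact_support
    ((hasCompactSupport_annulusBump (V := V)).iteratedFDeriv n)
  refine ⟨C, (norm_nonneg _).trans (hC 0), fun p => ?_⟩
  have h := ContinuousLinearMap.iteratedFDeriv_comp_right (ContinuousLinearMap.fst ℝ V ℝ)
    (contDiff_annulusBump (V := V)) p (i := n) (by exact_mod_cast le_top)
  change ‖iteratedFDeriv ℝ n (annulusBump ∘ (ContinuousLinearMap.fst ℝ V ℝ)) p‖ ≤ C
  rw [h]
  refine (ContinuousMultilinearMap.norm_compContinuousLinearMap_le _ _).trans ?_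
  refine (mul_le_of_le_one_right (norm_nonneg _) ?_).trans (hC _)
  exact Finset.prod_le_one (fun _ _ => norm_nonneg _)
    fun _ _ => ContinuousLinearMap.norm_fst_le ℝ V ℝ

/-- Leibniz' rule on the open set where x ≠ 0; the constant depends on the bump alone, which makes
the bound usable for continuity in f. -/
theorem exists_norm_iteratedFDeriv_cutoff_le [ProperSpace V] (n : ℕ) : ∃ C : ℝ, 0 ≤ C ∧
    ∀ f : V × ℝ → F, ContDiffOn ℝ ∞ f {p | p.1 ≠ 0} → ∀ p : V × ℝ, p.1 ∈ annulus V →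
      ‖iteratedFDeriv ℝ n (fun q => annulusBump q.1 • f q) p‖ ≤
        C * ∑ i ∈ Finset.range (n + 1), ‖iteratedFDeriv ℝ i f p‖ := by
  choose M hM0 hM using exists_norm_iteratedFDeriv_annulusBump_le (V := V)
  refine ⟨∑ i ∈ Finset.range (n + 1), (n.choose i : ℝ) * M i,
    Finset.sum_nonneg fun i _ => mul_nonneg (Nat.cast_nonneg _) (hM0 i), fun f hf p hp => ?_⟩
  have hp0 : p ∈ {p : V × ℝ | p.1 ≠ 0} := ne_zero_of_mem_annulus hp
  have h := norm_iteratedFDerivWithin_smul_le (𝕜 := ℝ) (n := n)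
    ((contDiff_annulusBump (V := V)).comp contDiff_fst).contDiffOn hf
    isOpen_fst_ne_zero.uniqueDiffOn hp0 (by exact_mod_cast le_top)
  simp only [iteratedFDerivWithin_of_isOpen _ isOpen_fst_ne_zero hp0] at h
  refine h.trans ?_
  rw [Finset.sum_mul]
  refine Finset.sum_le_sum fun i hi => ?_
  refine mul_le_mul (mul_le_mul_of_nonneg_left (hM i p) (Nat.cast_nonneg _)) ?_ (norm_nonneg _)
    (mul_nonneg (Nat.cast_nonneg _) (hM0 i))
  exact Finset.single_le_sum (f := fun i => ‖iteratedFDeriv ℝ i f p‖) (fun _ _ => norm_nonneg _)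
    (Finset.mem_range.2 (by omega : n - i < n + 1))

/-- A smooth function with compact support, equal to `x / |x|` near the unit sphere. -/
def cutNormalize (x : V) : V := annulusBump x • ‖x‖⁻¹ • x

theorem hasTemperateGrowth_cutNormalize [FiniteDimensional ℝ V] :
    Function.HasTemperateGrowth fun p : V × ℝ => (cutNormalize p.1, p.2) := by
  have h1 : ContDiff ℝ ∞ (cutNormalize : V → V) := by
    have h0 : ContDiffOn ℝ ∞ (fun p : V × ℝ => ‖p.1‖⁻¹ • p.1) {p | p.1 ≠ 0} := by
      intro p hp
      have hp' : p.1 ≠ 0 := hp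
      exact (((contDiffAt_fst.norm ℝ hp').inv (norm_ne_zero_iff.2 hp')).smul
        contDiffAt_fst).contDiffWithinAt
    have h2 : ContDiff ℝ ∞ fun x : V => (x, (0 : ℝ)) := contDiff_id.prodMk contDiff_const
    exact (contDiff_cutoff h0).comp h2
  have h2 : HasCompactSupport (cutNormalize : V → V) :=
    hasCompactSupport_annulusBump.smul_right
  have h3 : (fun p : V × ℝ => (cutNormalize p.1, p.2)) =
      (ContinuousLinearMap.inl ℝ (V) ℝ) ∘ cutNormalize ∘ (ContinuousLinearMap.fst ℝ (V) ℝ) +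
      ⇑((ContinuousLinearMap.inr ℝ (V) ℝ).comp (ContinuousLinearMap.snd ℝ (V) ℝ)) := by
    ext p <;> simp
  rw [h3]
  exact ((ContinuousLinearMap.hasTemperateGrowth _).comp ((h2.hasTemperateGrowth h1).comp
    (ContinuousLinearMap.hasTemperateGrowth _))).add (ContinuousLinearMap.hasTemperateGrowth _)

end Cutoff

/-! ### Composition of Schwartz functions with maps that are proper only on a subset -/

section CompOn

variable {D V F : Type} [NormedAddCommGroup D] [NormedSpace ℝ D] [NormedAddCommGroup V]
  [NormedSpace ℝ V] [NormedAddCommGroup F] [NormedSpace ℝ F]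

/-- The growth condition on g is required only on s because the maps in question degenerate
elsewhere: (x, w) ↦ -wx collapses at x = 0, and the cut-off normalization vanishes far from the
sphere. -/
theorem exists_norm_iteratedFDeriv_comp_le_on {g : D → V} (hg : g.HasTemperateGrowth) {s : Set D}
    {C : ℝ}
    (hs : ∀ x ∈ s, ‖x‖ ≤ C * (1 + ‖g x‖)) (k n : ℕ) :
    ∃ q : 𝓢(V, F) → ℝ, Continuous q ∧ q 0 = 0 ∧ ∀ f : 𝓢(V, F), ∀ x ∈ s,
      ‖x‖ ^ k * ‖iteratedFDeriv ℝ n (f ∘ g) x‖ ≤ q f := by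
  obtain ⟨l, B, hB, hgrowth⟩ := hg.norm_iteratedFDeriv_le_uniform n
  -- The weight has to absorb |x|^k and the growth (1 + |x|)^(l n) of the derivatives of g.
  set K := k + l * n with hK
  refine ⟨fun f => (1 + C) ^ K * ((B + 1) ^ n * n.factorial *
    (2 ^ K * ((Finset.Iic (K, n)).sup (schwartzSeminormFamily ℝ V F)) f)), ?_, by simp, ?_⟩
  · refine ((Seminorm.continuous_finsetSup fun i _ => ?_).const_mul _ |>.const_mul _).const_mul _
    exact (schwartz_withSeminorms ℝ V F).continuous_seminorm i
  intro f x hx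
  set S := ((Finset.Iic (K, n)).sup (schwartzSeminormFamily ℝ V F)) f
  have hgx : 0 < 1 + ‖g x‖ := by positivity
  have hup : (1 + ‖x‖) ^ K ≤ (1 + C) ^ K * (1 + ‖g x‖) ^ K := by
    rw [← mul_pow]
    refine pow_le_pow_left₀ (by positivity) ?_ _
    nlinarith [hs x hx, norm_nonneg (g x)]
  have hbound : ∀ i ≤ n, ‖iteratedFDeriv ℝ i f (g x)‖ ≤ 2 ^ K * S / (1 + ‖g x‖) ^ K := by
    intro i hi
    rw [le_div_iff₀' (by positivity)]
    exact SchwartzMap.one_add_le_sup_seminorm_apply (𝕜 := ℝ) (m := (K, n)) le_rfl hi f (g x)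
  -- The bound for derivatives of a composition needs geometric growth in N; passing from B to B + 1
  -- ≥ 1 permits raising to the power N.
  have hgrowth' : ∀ N, 1 ≤ N → N ≤ n →
      ‖iteratedFDeriv ℝ N g x‖ ≤ ((B + 1) * (1 + ‖x‖) ^ l) ^ N := by
    intro N hN1 hN
    refine (hgrowth N hN x).trans ?_
    rw [mul_pow]
    have hN' : N ≠ 0 := by omega
    have h1 : (1 : ℝ) ≤ 1 + ‖x‖ := by linarith [norm_nonneg x]
    gcongr
    · exact le_trans (by simp) (le_self_pow₀ (by linarith) hN')
    · exact le_self_pow₀ (one_le_pow₀ h1) hN'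
  have h := norm_iteratedFDeriv_comp_le (f.smooth ⊤) hg.1 (by exact_mod_cast le_top) x hbound
    hgrowth'
  have hxk : ‖x‖ ^ k ≤ (1 + ‖x‖) ^ k := by
    gcongr
    linarith
  have hSn : 0 ≤ S := apply_nonneg _ _
  calc ‖x‖ ^ k * ‖iteratedFDeriv ℝ n (f ∘ g) x‖
      ≤ (1 + ‖x‖) ^ k * (n.factorial * (2 ^ K * S / (1 + ‖g x‖) ^ K) *
          ((B + 1) * (1 + ‖x‖) ^ l) ^ n) := by gcongr
    _ = (1 + ‖x‖) ^ K / (1 + ‖g x‖) ^ K * ((B + 1) ^ n * n.factorial * (2 ^ K * S)) := by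
        rw [mul_pow, hK, pow_add, pow_mul]
        ring
    _ ≤ (1 + C) ^ K * ((B + 1) ^ n * n.factorial * (2 ^ K * S)) := by
        gcongr
        rwa [div_le_iff₀ (by positivity)]

end CompOn

/-! ### Extension and restriction -/

section ExtRes

variable {d : ℕ} [NeZero d]

instance : IsTopologicalAddGroup (SchwartzXi d) := (schwartzXi_withSeminorms d).topologicalAddGroup

instance : ContinuousSMul ℂ (SchwartzXi d) := (schwartzXi_withSeminorms d).continuousSMul

theorem continuous_schwartzXi_seminorm (k m : ℕ) : Continuous (SchwartzXi.seminorm d k m) :=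
  (schwartzXi_withSeminorms d).continuous_seminorm (k, m)

theorem SchwartzXi.decayAt_le_seminorm (ψ : SchwartzXi d) (k m : ℕ) (ξ : Xi d) :
    decayAt k m ψ ξ ≤ SchwartzXi.seminorm d k m ψ := le_ciSup (ψ.bddAbove k m) ξ

theorem SchwartzXi.contDiffOn_homExt (ψ : SchwartzXi d) :
    ContDiffOn ℝ ∞ (homExt ψ) {p | p.1 ≠ 0} := fun _ hp =>
  (contDiffAt_homExt ψ.smooth hp).contDiffWithinAt

theorem homExt_smul_fst {d : ℕ} (ψ : Xi d → ℂ) {c : ℝ} (hc : 0 < c) (p : E d × ℝ) :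
    homExt ψ (c • p.1, p.2) = homExt ψ p := by
  by_cases h : p.1 = 0
  · simp [homExt, h]
  · have h' : c • p.1 ≠ 0 := by simp [h, hc.ne']
    unfold homExt
    rw [dif_pos h', dif_pos h]
    congr 2
    refine Subtype.ext ?_
    simp only [norm_smul, Real.norm_of_nonneg hc.le, smul_smul]
    congr 1
    field_simp

/-- The extension is invariant under scaling of the first variable. Scaling by 1/|x| moves the point
to the sphere, where the seminorms live, and has operator norm at most 2 on the annulus. -/
theorem norm_iteratedFDeriv_homExt_le {d : ℕ} (ψ : Xi d → ℂ) (n : ℕ) {p : E d × ℝ}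
    (hp : p.1 ∈ annulus (E d)) : ‖iteratedFDeriv ℝ n (homExt ψ) p‖ ≤
      2 ^ n * ‖iteratedFDeriv ℝ n (homExt ψ) (‖p.1‖⁻¹ • p.1, p.2)‖ := by
  have h0 : 0 < ‖p.1‖ := norm_pos_iff.2 (ne_zero_of_mem_annulus hp)
  let u : ℝˣ := Units.mk0 ‖p.1‖⁻¹ (inv_ne_zero h0.ne')
  let L : (E d × ℝ) ≃L[ℝ] (E d × ℝ) :=
    (ContinuousLinearEquiv.smulLeft u).prodCongr (ContinuousLinearEquiv.refl ℝ ℝ)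
  have hL : homExt ψ ∘ L = homExt ψ := funext fun q => homExt_smul_fst ψ (inv_pos.2 h0) q
  have hLn : ‖(L : (E d × ℝ) →L[ℝ] (E d × ℝ))‖ ≤ 2 := by
    refine ContinuousLinearMap.opNorm_le_bound _ two_pos.le fun q => ?_
    have h1 : ‖‖p.1‖⁻¹ • q.1‖ ≤ 2 * ‖q‖ := by
      rw [norm_smul, norm_inv, norm_norm]
      exact mul_le_mul (inv_norm_le_of_mem_annulus hp) (norm_fst_le q) (norm_nonneg _) two_pos.le
    have h2 : ‖q.2‖ ≤ 2 * ‖q‖ := by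
      linarith [norm_snd_le q, norm_nonneg q]
    exact max_le h1 h2
  have h := ContinuousLinearEquiv.iteratedFDerivWithin_comp_right L (homExt ψ)
    uniqueDiffOn_univ (x := p) (Set.mem_univ _) n
  rw [Set.preimage_univ, iteratedFDerivWithin_univ, iteratedFDerivWithin_univ, hL] at h
  rw [h]
  refine (ContinuousMultilinearMap.norm_compContinuousLinearMap_le _ _).trans ?_
  rw [mul_comm]
  refine mul_le_mul_of_nonneg_right ?_ (norm_nonneg _)
  rw [Finset.prod_const, Finset.card_univ, Fintype.card_fin]
  exact pow_le_pow_left₀ (norm_nonneg _) hLn n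

/-- The extension of a function in `𝓢(Ξ)` to a Schwartz function on `ℝ^d × ℝ`. -/
def extendXi (d : ℕ) [NeZero d] : SchwartzXi d →L[ℂ] 𝓢(E d × ℝ, ℂ) :=
  schwartzCLM (fun ψ p => annulusBump p.1 • homExt ψ p)
    (fun f g p => by rw [SchwartzXi.coe_add, homExt_add, Pi.add_apply, smul_add])
    (fun a f p => by rw [SchwartzXi.coe_smul, homExt_smul, Pi.smul_apply, smul_comm])
    (fun f => contDiff_cutoff f.contDiffOn_homExt)
    (fun k n => by
      obtain ⟨C, hC, h⟩ := exists_norm_iteratedFDeriv_cutoff_le (V := E d) (F := ℂ) n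
      refine ⟨fun ψ => 2 ^ k * (C * ∑ i ∈ Finset.range (n + 1),
        2 ^ i * SchwartzXi.seminorm d k i ψ), ?_, by simp, fun ψ p => ?_⟩
      · exact ((continuous_finsetSum _ fun i _ =>
          (continuous_schwartzXi_seminorm k i).const_mul _).const_mul _).const_mul _
      by_cases hp : p.1 ∈ annulus (E d)
      · have hw : ‖p‖ ≤ 2 * Real.sqrt (1 + p.2 ^ 2) := by
          have h1 : 1 ≤ Real.sqrt (1 + p.2 ^ 2) := by
            rw [Real.one_le_sqrt]
            nlinarith [sq_nonneg p.2]
          have h2 : |p.2| ≤ Real.sqrt (1 + p.2 ^ 2) := Real.abs_le_sqrt (by linarith)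
          refine max_le ?_ ?_
          · linarith [norm_le_of_mem_annulus hp]
          · rw [Real.norm_eq_abs]
            linarith
        have h0 : p.1 ≠ 0 := ne_zero_of_mem_annulus hp
        let ξ : Xi d := (⟨‖p.1‖⁻¹ • p.1, by simp [norm_smul, h0]⟩, p.2)
        calc ‖p‖ ^ k * ‖iteratedFDeriv ℝ n (fun q => annulusBump q.1 • homExt ψ q) p‖
            ≤ (2 * Real.sqrt (1 + p.2 ^ 2)) ^ k *
                (C * ∑ i ∈ Finset.range (n + 1), ‖iteratedFDeriv ℝ i (homExt ψ) p‖) := by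
              gcongr
              exact h _ ψ.contDiffOn_homExt p hp
          _ = 2 ^ k * (C * ∑ i ∈ Finset.range (n + 1),
                Real.sqrt (1 + p.2 ^ 2) ^ k * ‖iteratedFDeriv ℝ i (homExt ψ) p‖) := by
              rw [← Finset.mul_sum]
              ring
          _ ≤ 2 ^ k * (C * ∑ i ∈ Finset.range (n + 1),
                2 ^ i * SchwartzXi.seminorm d k i ψ) := by
              refine mul_le_mul_of_nonneg_left (mul_le_mul_of_nonneg_left
                (Finset.sum_le_sum fun i _ => ?_) hC) (by positivity)
              calc Real.sqrt (1 + p.2 ^ 2) ^ k * ‖iteratedFDeriv ℝ i (homExt ψ) p‖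
                  ≤ Real.sqrt (1 + p.2 ^ 2) ^ k *
                    (2 ^ i * ‖iteratedFDeriv ℝ i (homExt ψ) (‖p.1‖⁻¹ • p.1, p.2)‖) := by
                    gcongr
                    exact norm_iteratedFDeriv_homExt_le ψ i hp
                _ = 2 ^ i * decayAt k i ψ ξ := by
                    rw [decayAt]
                    ring
                _ ≤ _ := by
                    gcongr
                    exact ψ.decayAt_le_seminorm k i ξ
      · rw [iteratedFDeriv_cutoff_of_notMem _ _ hp, norm_zero, mul_zero]
        positivity)

theorem extendXi_apply (ψ : SchwartzXi d) (ξ : Xi d) :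
    extendXi d ψ (ξ.1, ξ.2) = ψ ξ := by
  have h1 : ‖(ξ.1 : E d)‖ = 1 := norm_eq_of_mem_sphere ξ.1
  change annulusBump (ξ.1 : E d) • homExt ψ ((ξ.1 : E d), ξ.2) = _
  rw [homExt_coe, (annulusBump_eventuallyEq h1).self_of_nhds, one_smul]

theorem isSmoothXi_restrict (Ψ : 𝓢(E d × ℝ, ℂ)) :
    IsSmoothXi fun ξ : Xi d => Ψ ((ξ.1 : E d), ξ.2) := by
  have h1 : ContMDiff ((𝓡 (d - 1)).prod 𝓘(ℝ, ℝ)) 𝓘(ℝ, E d) ∞ fun ξ : Xi d => (ξ.1 : E d) :=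
    (contMDiff_coe_sphere (n := d - 1)).comp contMDiff_fst
  have h2 : ContMDiff ((𝓡 (d - 1)).prod 𝓘(ℝ, ℝ)) 𝓘(ℝ, ℝ) ∞ fun ξ : Xi d => ξ.2 :=
    contMDiff_snd
  exact (Ψ.smooth ⊤).contMDiff.comp (h1.prodMk_space h2)

/-- Replacing x / |x| by its cut-off version gives a map of temperate growth on the whole space
without changing any derivative on the sphere. -/
theorem homExt_restrict_eventuallyEq {d : ℕ} (Ψ : E d × ℝ → ℂ) (ξ : Xi d) :
    homExt (fun ξ : Xi d => Ψ ((ξ.1 : E d), ξ.2)) =ᶠ[nhds ((ξ.1 : E d), ξ.2)]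
      Ψ ∘ fun p : E d × ℝ => (cutNormalize p.1, p.2) := by
  have h1 : ‖(ξ.1 : E d)‖ = 1 := norm_eq_of_mem_sphere ξ.1
  have h2 : ∀ᶠ p : E d × ℝ in nhds ((ξ.1 : E d), ξ.2), annulusBump p.1 = 1 :=
    (continuous_fst.tendsto ((ξ.1 : E d), ξ.2)).eventually (annulusBump_eventuallyEq h1)
  have h3 : ∀ᶠ p : E d × ℝ in nhds ((ξ.1 : E d), ξ.2), p.1 ≠ 0 :=
    isOpen_fst_ne_zero.mem_nhds (fun h => by
      have h0 : (ξ.1 : E d) = 0 := h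
      simp [h0] at h1)
  filter_upwards [h2, h3] with p hp hp0
  simp [homExt, hp0, cutNormalize, hp]

theorem exists_decayAt_restrict_le {d : ℕ} (k m : ℕ) :
    ∃ q : 𝓢(E d × ℝ, ℂ) → ℝ, Continuous q ∧ q 0 = 0 ∧
    ∀ (Ψ : 𝓢(E d × ℝ, ℂ)) (ξ : Xi d),
      decayAt k m (fun ξ : Xi d => Ψ ((ξ.1 : E d), ξ.2)) ξ ≤ q Ψ := by
  have hval : ∀ x : E d, ‖x‖ = 1 → cutNormalize x = x := fun x hx => by
    simp [cutNormalize, (annulusBump_eventuallyEq hx).self_of_nhds, hx]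
  obtain ⟨q, hq, hq0, hle⟩ := exists_norm_iteratedFDeriv_comp_le_on (F := ℂ)
    (hasTemperateGrowth_cutNormalize (V := E d)) (s := {p | ‖p.1‖ = 1}) (C := 1)
    (fun p hp => by
      rw [hval p.1 hp]
      linarith) k m
  refine ⟨fun Ψ => 2 ^ k * q Ψ, hq.const_mul _, by simp [hq0], fun Ψ ξ => ?_⟩
  have h1 : ‖(ξ.1 : E d)‖ = 1 := norm_eq_of_mem_sphere ξ.1
  rw [decayAt, ((homExt_restrict_eventuallyEq Ψ ξ).iteratedFDeriv ℝ m).eq_of_nhds]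
  have hw : Real.sqrt (1 + ξ.2 ^ 2) ≤ 2 * ‖((ξ.1 : E d), ξ.2)‖ := by
    have h2 : 1 ≤ ‖((ξ.1 : E d), ξ.2)‖ := h1.symm.le.trans (norm_fst_le ((ξ.1 : E d), ξ.2))
    have h3 : |ξ.2| ≤ ‖((ξ.1 : E d), ξ.2)‖ := norm_snd_le ((ξ.1 : E d), ξ.2)
    refine Real.sqrt_le_iff.2 ⟨by positivity, ?_⟩
    have h4 : ξ.2 ^ 2 ≤ ‖((ξ.1 : E d), ξ.2)‖ ^ 2 := by
      rw [← sq_abs]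
      gcongr
    nlinarith
  calc _ ≤ (2 * ‖((ξ.1 : E d), ξ.2)‖) ^ k * ‖iteratedFDeriv ℝ m
        (Ψ ∘ fun p : E d × ℝ => (cutNormalize p.1, p.2)) ((ξ.1 : E d), ξ.2)‖ := by gcongr
    _ = 2 ^ k * (‖((ξ.1 : E d), ξ.2)‖ ^ k * ‖iteratedFDeriv ℝ m
        (Ψ ∘ fun p : E d × ℝ => (cutNormalize p.1, p.2)) ((ξ.1 : E d), ξ.2)‖) := by ring
    _ ≤ 2 ^ k * q Ψ := by
      gcongr
      exact hle Ψ ((ξ.1 : E d), ξ.2) h1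

/-- The restriction of Schwartz functions from `ℝ^d × ℝ` to `Ξ`. -/
def restrictXi (d : ℕ) [NeZero d] : 𝓢(E d × ℝ, ℂ) →L[ℂ] SchwartzXi d where
  toFun Ψ := ⟨fun ξ => Ψ ((ξ.1 : E d), ξ.2), isSmoothXi_restrict Ψ, fun k m =>
    (exists_decayAt_restrict_le k m).elim fun q hq => ⟨q Ψ, hq.2.2 Ψ⟩⟩
  map_add' _ _ := rfl
  map_smul' _ _ := rfl
  cont := by
    refine continuous_of_seminorm_le (schwartzXi_withSeminorms d)
      { toFun := fun Ψ : 𝓢(E d × ℝ, ℂ) => (⟨fun ξ => Ψ ((ξ.1 : E d), ξ.2), isSmoothXi_restrict Ψ,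
          fun k m => (exists_decayAt_restrict_le k m).elim fun q hq =>
            ⟨q Ψ, hq.2.2 Ψ⟩⟩ : SchwartzXi d)
        map_add' := fun _ _ => rfl
        map_smul' := fun _ _ => rfl } fun i => ?_
    obtain ⟨q, hq, hq0, hle⟩ := exists_decayAt_restrict_le (d := d) i.1 i.2
    refine ⟨q, hq, hq0, fun Ψ => ?_⟩
    -- Any point of Ξ shows that the bound is nonnegative; a unit coordinate vector exists since d ≥
    -- 1.
    have h0 : 0 ≤ q Ψ :=
      (decayAt_nonneg i.1 i.2 _ _).trans (hle Ψ (⟨EuclideanSpace.single 0 1, by simp⟩, 0))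
    exact Real.iSup_le (hle Ψ) h0

theorem hasTemperateGrowth_neg_smul {d : ℕ} : Function.HasTemperateGrowth fun p : E d × ℝ =>
    -(p.2 • p.1) := by
  refine Function.HasTemperateGrowth.neg (f := fun p : E d × ℝ => p.2 • p.1) ?_
  exact (ContinuousLinearMap.snd ℝ (E d) ℝ).hasTemperateGrowth.smul
    (ContinuousLinearMap.fst ℝ (E d) ℝ).hasTemperateGrowth

/-- The pull-back of a Schwartz function on `ℝ^d` under `(x, w) ↦ -w x`, cut off near the unit
sphere. -/
def pullRay (d : ℕ) [NeZero d] : 𝓢(E d, ℂ) →L[ℂ] 𝓢(E d × ℝ, ℂ) :=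
  schwartzCLM (fun h p => annulusBump p.1 • (h ∘ fun p : E d × ℝ => -(p.2 • p.1)) p)
    (fun f g p => by simp)
    (fun a f p => by simp [mul_left_comm])
    (fun f => contDiff_cutoff ((f.smooth ⊤).comp hasTemperateGrowth_neg_smul.1).contDiffOn)
    (fun k n => by
      obtain ⟨C, hC, h⟩ := exists_norm_iteratedFDeriv_cutoff_le (V := E d) (F := ℂ) n
      choose q hq hq0 hle using fun i => exists_norm_iteratedFDeriv_comp_le_on (F := ℂ)
        (hasTemperateGrowth_neg_smul (d := d)) (s := {p | p.1 ∈ annulus (E d)}) (C := 2)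
        (fun p hp => by
          have h1 := norm_le_of_mem_annulus hp
          have h2 := inv_norm_le_of_mem_annulus hp
          have h0 : 0 < ‖p.1‖ := norm_pos_iff.2 (ne_zero_of_mem_annulus hp)
          rw [norm_neg, norm_smul]
          have h3 : ‖p.2‖ ≤ 2 * (‖p.2‖ * ‖p.1‖) := by
            rw [inv_le_comm₀ h0 two_pos] at h2
            nlinarith [norm_nonneg p.2]
          refine max_le ?_ (by linarith)
          nlinarith [mul_nonneg (norm_nonneg p.2) h0.le]) k i
      refine ⟨fun f => C * ∑ i ∈ Finset.range (n + 1), |q i f|, ?_, by simp [hq0], fun f p => ?_⟩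
      · exact (continuous_finsetSum _ fun i _ => (hq i).abs).const_mul _
      by_cases hp : p.1 ∈ annulus (E d)
      · calc _ ≤ ‖p‖ ^ k * (C * ∑ i ∈ Finset.range (n + 1),
              ‖iteratedFDeriv ℝ i (f ∘ fun p : E d × ℝ => -(p.2 • p.1)) p‖) := by
              gcongr
              exact h _ ((f.smooth ⊤).comp hasTemperateGrowth_neg_smul.1).contDiffOn p hp
          _ = C * ∑ i ∈ Finset.range (n + 1), ‖p‖ ^ k *
              ‖iteratedFDeriv ℝ i (f ∘ fun p : E d × ℝ => -(p.2 • p.1)) p‖ := by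
              rw [← Finset.mul_sum]
              ring
          _ ≤ C * ∑ i ∈ Finset.range (n + 1), |q i f| := by
              gcongr with i hi
              exact (hle i f p hp).trans (le_abs_self _)
      · rw [iteratedFDeriv_cutoff_of_notMem _ _ hp, norm_zero, mul_zero]
        exact mul_nonneg hC (Finset.sum_nonneg fun _ _ => abs_nonneg _))

theorem pullRay_apply (h : 𝓢(E d, ℂ)) (n : Sph d) (w : ℝ) :
    pullRay d h ((n : E d), w) = h (-(w • (n : E d))) := by
  have h1 : ‖(n : E d)‖ = 1 := norm_eq_of_mem_sphere n
  change annulusBump (n : E d) • h (-(w • (n : E d))) = _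
  rw [(annulusBump_eventuallyEq h1).self_of_nhds, one_smul]

end ExtRes

open LineDeriv

/-! ### Moments and the Fourier transform -/

/-- All derivatives of `f` at the origin vanish. -/
def FlatAtZero {V : Type} [NormedAddCommGroup V] [NormedSpace ℝ V] (f : V → ℂ) : Prop :=
  ∀ n : ℕ, iteratedFDeriv ℝ n f 0 = 0

section FlatAtZero

variable {V : Type} [NormedAddCommGroup V] [InnerProductSpace ℝ V]

theorem FlatAtZero.apply_zero {f : V → ℂ} (hf : FlatAtZero f) : f 0 = 0 := by
  simpa using congrArg norm (hf 0)

theorem FlatAtZero.lineDeriv {h : 𝓢(V, ℂ)} (hh : FlatAtZero h) (v : V) :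
    FlatAtZero (∂_{v} h : 𝓢(V, ℂ)) := fun n => by
  rw [← norm_le_zero_iff]
  have h1 : ‖iteratedFDeriv ℝ n (fun x => SchwartzMap.fderivCLM ℝ V ℂ h x v) 0‖ ≤ _ :=
    norm_iteratedFDeriv_clm_apply_const
      ((SchwartzMap.fderivCLM ℝ V ℂ h).smooth ⊤).contDiffAt (by exact_mod_cast le_top)
  refine h1.trans_eq ?_
  change ‖v‖ * ‖iteratedFDeriv ℝ n (fderiv ℝ h) 0‖ = 0
  rw [norm_iteratedFDeriv_fderiv, hh, norm_zero, mul_zero]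

theorem FlatAtZero.mul {f g : V → ℂ} (hf : FlatAtZero f) (hfs : ContDiff ℝ ∞ f)
    (hgs : ContDiff ℝ ∞ g) : FlatAtZero fun x => f x * g x := fun n => by
  rw [← norm_le_zero_iff]
  refine (norm_iteratedFDeriv_mul_le hfs hgs 0 (n := n) (by exact_mod_cast le_top)).trans_eq ?_
  exact Finset.sum_eq_zero fun i _ => by rw [hf i, norm_zero]; ring

variable [FiniteDimensional ℝ V] [MeasurableSpace V] [BorelSpace V]

theorem integral_fourierInv (h : 𝓢(V, ℂ)) : ∫ x, (𝓕⁻ h) x = h 0 := by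
  have h1 : 𝓕 (𝓕⁻ h) = h := FourierTransform.fourier_fourierInv_eq h
  have h2 : (𝓕 (𝓕⁻ h)) 0 = h 0 := by rw [h1]
  rw [← h2, SchwartzMap.fourier_coe, Real.fourier_eq']
  simp

/-- Multiplication by a linear form is differentiation on the Fourier side. The integrands agree
pointwise up to the constant, so P is arbitrary; this is the degree-lowering step in the moment
inductions. -/
theorem integral_fourierInv_mul_inner (h : 𝓢(V, ℂ)) (v : V) (P : V → ℂ) :
    ∫ x, (𝓕⁻ h) x * (P x * (inner ℝ x v : ℝ)) =
      -(2 * Real.pi * Complex.I)⁻¹ * ∫ x, (𝓕⁻ (∂_{v} h)) x * P x := by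
  have ht : Function.HasTemperateGrowth fun x : V => (inner ℝ x v : ℝ) :=
    ((innerSL ℝ).flip v).hasTemperateGrowth
  rw [← integral_const_mul]
  congr 1
  funext x
  rw [SchwartzMap.fourierInv_lineDerivOp_eq, smul_apply,
    SchwartzMap.smulLeftCLM_apply_apply ht, smul_eq_mul, Complex.real_smul]
  have : (2 * Real.pi * Complex.I : ℂ) ≠ 0 := by simp [Real.pi_ne_zero]
  field_simp

theorem integrable_mul_polynomial (u : 𝓢(ℝ, ℂ)) (p : Polynomial ℂ) :
    Integrable fun t : ℝ => u t * p.eval (t : ℂ) := by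
  have hp : (fun t : ℝ => p.eval (t : ℂ)).HasTemperateGrowth := by
    induction p using Polynomial.induction_on' with
    | add p q hp hq =>
      simp only [Polynomial.eval_add]
      exact hp.add hq
    | monomial k a =>
      simp only [Polynomial.eval_monomial]
      exact (Function.HasTemperateGrowth.const a).mul
        (Function.Complex.hasTemperateGrowth_ofReal.pow k)
  refine (SchwartzMap.smulLeftCLM ℂ (fun t : ℝ => p.eval (t : ℂ)) u).integrable.congr
    (Filter.Eventually.of_forall fun t => ?_)
  rw [SchwartzMap.smulLeftCLM_apply_apply hp, smul_eq_mul, mul_comm]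

theorem integral_fourierInv_mul_polynomial {u : 𝓢(ℝ, ℂ)} (hu : FlatAtZero u) (p : Polynomial ℂ) :
    ∫ t : ℝ, (𝓕⁻ u) t * p.eval (t : ℂ) = 0 := by
  induction p using Polynomial.induction_on generalizing u with
  | C a =>
    simp only [Polynomial.eval_C]
    rw [integral_mul_const, integral_fourierInv, hu.apply_zero, zero_mul]
  | add p q hp hq =>
    simp only [Polynomial.eval_add, mul_add]
    rw [integral_add (integrable_mul_polynomial _ p) (integrable_mul_polynomial _ q), hp hu, hq hu,
      add_zero]
  | monomial k a hk =>
    have h1 := integral_fourierInv_mul_inner u (1 : ℝ)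
      fun t : ℝ => (Polynomial.C a * Polynomial.X ^ k).eval (t : ℂ)
    rw [hk (hu.lineDeriv 1), mul_zero] at h1
    rw [← h1]
    simp [pow_succ, mul_assoc]

end FlatAtZero

/-! ### Lizorkin functions on ℝ^d and flatness of the Fourier transform at the origin -/

section Euclidean

variable {d : ℕ}

theorem fourierInv_mem_lizorkinE {h : 𝓢(E d, ℂ)} (hh : FlatAtZero h) :
    (𝓕⁻ h : 𝓢(E d, ℂ)) ∈ LizorkinE d := by
  intro p
  induction p using MvPolynomial.induction_on generalizing h with
  | C a =>
    simp only [MvPolynomial.eval_C]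
    rw [integral_mul_const, integral_fourierInv, hh.apply_zero, zero_mul]
  | add p q hp hq =>
    simp only [map_add, mul_add]
    rw [integral_add (integrable_mul_mvPolynomial _ p) (integrable_mul_mvPolynomial _ q), hp hh,
      hq hh, add_zero]
  | mul_X p i hp =>
    have h1 := integral_fourierInv_mul_inner h (EuclideanSpace.single i (1 : ℝ))
      fun x : E d => MvPolynomial.eval (fun i => (x i : ℂ)) p
    rw [hp (hh.lineDeriv _), mul_zero] at h1
    rw [← h1]
    simp [EuclideanSpace.inner_single_right]

theorem smulLeft_inner_mem_lizorkinE {φ : 𝓢(E d, ℂ)} (hφ : φ ∈ LizorkinE d) (v : E d) :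
    SchwartzMap.smulLeftCLM ℂ (inner ℝ · v : E d → ℝ) φ ∈ LizorkinE d := by
  intro p
  have ht : Function.HasTemperateGrowth fun x : E d => (inner ℝ x v : ℝ) :=
    ((innerSL ℝ).flip v).hasTemperateGrowth
  -- The linear form x ↦ ⟨x, v⟩, written as a polynomial, is absorbed into p.
  rw [← hφ (p * ∑ i, MvPolynomial.C (v i : ℂ) * MvPolynomial.X i)]
  congr 1
  funext x
  rw [SchwartzMap.smulLeftCLM_apply_apply ht, Complex.real_smul, PiLp.inner_apply]
  simp
  ring

/-- A directional derivative of the transform is the transform of φ times a linear form, up to a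
constant, and such products stay in the Lizorkin space; the value at 0 is the integral. -/
theorem flatAtZero_fourier {φ : 𝓢(E d, ℂ)} (hφ : φ ∈ LizorkinE d) :
    FlatAtZero (𝓕 φ : 𝓢(E d, ℂ)) := by
  intro n
  ext m
  rw [← SchwartzMap.iteratedLineDerivOp_eq_iteratedFDeriv]
  induction n generalizing φ with
  | zero =>
    have := hφ 1
    simpa [SchwartzMap.fourier_coe, Real.fourier_eq'] using this
  | succ n ih =>
    rw [iteratedLineDerivOp_succ_right, SchwartzMap.lineDerivOp_fourier_eq]
    exact ih ((LizorkinE d).smul_mem _ (smulLeft_inner_mem_lizorkinE hφ _)) _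

end Euclidean

/-! ### Analysis, synthesis and the operators on test functions -/

section Operators

variable {d : ℕ} [NeZero d]

/-- The restriction of a function in `𝓢(Ξ)` to `{n} × ℝ`. -/
def sliceXi (ψ : SchwartzXi d) (n : Sph d) : 𝓢(ℝ, ℂ) := slice (n : E d) (extendXi d ψ)

@[simp]
theorem sliceXi_apply (ψ : SchwartzXi d) (n : Sph d) (t : ℝ) : sliceXi ψ n t = ψ (n, t) :=
  extendXi_apply ψ (n, t)

/-- The restriction of a Schwartz function on `ℝ^d` to the line `ℝ n`. -/
def ray (n : Sph d) : 𝓢(E d, ℂ) →L[ℂ] 𝓢(ℝ, ℂ) :=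
  SchwartzMap.compCLM ℂ (g := fun w : ℝ => w • (n : E d))
    (ContinuousLinearMap.toSpanSingleton ℝ (n : E d)).hasTemperateGrowth
    ⟨1, 1, fun w => by
      rw [norm_smul, norm_eq_of_mem_sphere n]
      simp⟩

@[simp]
theorem ray_apply {d : ℕ} (n : Sph d) (h : 𝓢(E d, ℂ)) (w : ℝ) : ray n h w = h (w • (n : E d)) := rfl

theorem flatAtZero_ray {d : ℕ} {h : 𝓢(E d, ℂ)} (hh : FlatAtZero h) (n : Sph d) :
    FlatAtZero (ray n h) := fun m => by
  have := (ContinuousLinearMap.toSpanSingleton ℝ (n : E d)).iteratedFDeriv_comp_right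
    (h.smooth ⊤) 0 (i := m) (by exact_mod_cast le_top)
  change iteratedFDeriv ℝ m (h ∘ ContinuousLinearMap.toSpanSingleton ℝ (n : E d)) 0 = 0
  rw [this, map_zero, hh m]
  rfl

/-- The operator with `synthesis h (n, ·)` the inverse Fourier transform of `w ↦ h (w n)`. -/
def synthesis (d : ℕ) [NeZero d] : 𝓢(E d, ℂ) →L[ℂ] SchwartzXi d :=
  (restrictXi d).comp (partialFourierCLM.comp (pullRay d))

/-- The minus sign in `pullRay` turns the forward partial Fourier transform into the inverse one. -/
theorem sliceXi_synthesis (h : 𝓢(E d, ℂ)) (n : Sph d) :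
    sliceXi (synthesis d h) n = 𝓕⁻ (ray n h) := by
  ext t
  rw [sliceXi_apply, SchwartzMap.fourierInv_coe, Real.fourierInv_eq_fourier_comp_neg]
  change partialFourierCLM (pullRay d h) ((n : E d), t) = _
  rw [partialFourierCLM_apply]
  simp [pullRay_apply]

theorem synthesis_apply (h : 𝓢(E d, ℂ)) (n : Sph d) (t : ℝ) :
    synthesis d h (n, t) = 𝓕⁻ (fun w : ℝ => h (w • (n : E d))) t := by
  rw [← sliceXi_apply, sliceXi_synthesis, SchwartzMap.fourierInv_coe]
  rfl

theorem fourier_sliceXi_synthesis (h : 𝓢(E d, ℂ)) (n : Sph d) :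
    𝓕 (sliceXi (synthesis d h) n) = ray n h := by
  rw [sliceXi_synthesis, FourierTransform.fourier_fourierInv_eq]

theorem synthesis_mem_lizorkinXi {h : 𝓢(E d, ℂ)} (hh : FlatAtZero h) :
    synthesis d h ∈ LizorkinXi d := by
  intro p n
  simp only [← sliceXi_apply, sliceXi_synthesis]
  exact integral_fourierInv_mul_polynomial (flatAtZero_ray hh n) p

theorem hasZeroMoments_extendXi (ψ : LizorkinXi d) : HasZeroMoments (extendXi d ψ.1) := by
  intro k x
  change ∫ t : ℝ, t ^ k • (annulusBump x • homExt ψ.1 (x, t)) = 0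
  by_cases hx : x = 0
  · simp [homExt, hx]
  have h := ψ.2 (Polynomial.X ^ k) ⟨‖x‖⁻¹ • x, by simp [norm_smul, hx]⟩
  simp only [smul_comm _ (annulusBump x)]
  rw [integral_smul]
  simp only [homExt, ne_eq, hx, not_false_eq_true, dif_pos]
  convert smul_zero (annulusBump x)
  rw [← h]
  congr 1
  funext t
  simp [mul_comm]

theorem isFlat_partialFourier_extendXi (ψ : LizorkinXi d) :
    IsFlat (partialFourierCLM (extendXi d ψ.1)) :=
  (hasZeroMoments_extendXi ψ).isFlat_partialFourier

/-- The operator `ψ ↦ |x|¹⁻ᵈ 𝓕 (ψ (x / |x|, ·)) (|x|)`. -/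
def analysis (d : ℕ) [NeZero d] : LizorkinXi d →L[ℂ] 𝓢(E d, ℂ) :=
  schwartzCLM (fun ψ => polarPull (d - 1) (partialFourierCLM (extendXi d ψ.1)))
    (fun f g x => by simp [polarPull])
    (fun a f x => by simp [polarPull, mul_left_comm])
    (fun f => contDiff_polarPull (isFlat_partialFourier_extendXi f) _)
    (fun k n => by
      obtain ⟨q, hq, hq0, hle⟩ := exists_polarPull_le (V := E d) (F := ℂ) (d - 1) k n
      refine ⟨fun ψ => q (partialFourierCLM (extendXi d ψ.1)), ?_, by simp [hq0],
        fun ψ x => hle _ (isFlat_partialFourier_extendXi ψ) x⟩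
      exact hq.comp (partialFourierCLM.continuous.comp
        ((extendXi d).continuous.comp continuous_subtype_val)))

theorem analysis_smul (ψ : LizorkinXi d) (n : Sph d) {r : ℝ} (hr : 0 < r) :
    analysis d ψ (r • (n : E d)) = (r⁻¹) ^ (d - 1) • 𝓕 (sliceXi ψ.1 n) r := by
  have h1 : ‖(n : E d)‖ = 1 := norm_eq_of_mem_sphere n
  have hn : ‖r • (n : E d)‖ = r := by rw [norm_smul, h1, mul_one, Real.norm_of_nonneg hr.le]
  change polarPull (d - 1) (partialFourierCLM (extendXi d ψ.1)) (r • (n : E d)) = _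
  rw [polarPull, hn, smul_smul, inv_mul_cancel₀ hr.ne', one_smul]
  rfl

theorem iteratedFDeriv_polarPull_zero {V F : Type} [NormedAddCommGroup V] [InnerProductSpace ℝ V]
    [NormedAddCommGroup F] [NormedSpace ℝ F] {Ψ : 𝓢(V × ℝ, F)} (h : IsFlat Ψ) (j n : ℕ) :
    ‖iteratedFDeriv ℝ n (polarPull j Ψ) 0‖ = 0 := by
  induction n generalizing F j with
  | zero => rw [norm_iteratedFDeriv_zero, polarPull_zero h, norm_zero]
  | succ n ih =>
    rw [← norm_iteratedFDeriv_fderiv, show fderiv ℝ (polarPull j Ψ) =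
      polarPull (j + 1) (polarDeriv j Ψ) from funext fun p => (hasFDerivAt_polarPull h j p).fderiv]
    exact ih (isFlat_polarDeriv h j) _

theorem flatAtZero_polarPull {V : Type} [NormedAddCommGroup V] [InnerProductSpace ℝ V]
    {Ψ : 𝓢(V × ℝ, ℂ)} (h : IsFlat Ψ) (j : ℕ) : FlatAtZero (polarPull j Ψ) := fun n =>
  norm_eq_zero.1 (iteratedFDeriv_polarPull_zero h j n)

theorem flatAtZero_analysis (ψ : LizorkinXi d) : FlatAtZero (analysis d ψ) :=
  flatAtZero_polarPull (isFlat_partialFourier_extendXi ψ) _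

/-- `analysis` only sees the half-line w > 0. Evenness recovers w < 0 by writing wn = (-w)(-n), and
at w = 0 both sides vanish by the zeroth moment and flatness. -/
theorem fourier_sliceXi_of_even {ψ : LizorkinXi d} (hψ : ψ ∈ LizorkinXiEven d) (n : Sph d)
    (w : ℝ) : 𝓕 (sliceXi ψ.1 n) w = |w| ^ (d - 1) • analysis d ψ (w • (n : E d)) := by
  rcases lt_trichotomy w 0 with hw | rfl | hw
  · have h1 : w • (n : E d) = (-w) • ((-n : Sph d) : E d) := by simp
    rw [h1, analysis_smul ψ (-n) (neg_pos.2 hw), abs_of_neg hw, smul_smul, ← mul_pow,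
      mul_inv_cancel₀ (by linarith), one_pow, one_smul]
    have h2 : ∀ t, ψ.1 (-n, -t) = ψ.1 (n, t) := fun t =>
      congrArg (fun χ : LizorkinXi d => χ.1 (n, t)) hψ
    rw [SchwartzMap.fourier_coe, SchwartzMap.fourier_coe, ← Real.fourierInv_eq_fourier_neg,
      Real.fourierInv_eq_fourier_comp_neg]
    refine congrArg (fun f : ℝ → ℂ => 𝓕 f w) (funext fun t => ?_)
    simp [← h2]
  · have h := ψ.2 1 n
    have h1 : 𝓕 (sliceXi ψ.1 n) 0 = 0 := by
      rw [SchwartzMap.fourier_coe, Real.fourier_eq']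
      simpa using h
    rw [h1, zero_smul, (flatAtZero_analysis ψ).apply_zero, smul_zero]
  · rw [analysis_smul ψ n hw, abs_of_pos hw, smul_smul, ← mul_pow, mul_inv_cancel₀ hw.ne', one_pow,
      one_smul]

theorem SchwartzXi.ext_fourier {ψ χ : SchwartzXi d}
    (h : ∀ n, 𝓕 (sliceXi ψ n) = 𝓕 (sliceXi χ n)) : ψ = χ := by
  refine DFunLike.ext _ _ fun ξ => ?_
  have h1 : 𝓕⁻ (𝓕 (sliceXi ψ ξ.1)) = 𝓕⁻ (𝓕 (sliceXi χ ξ.1)) := by rw [h]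
  rw [FourierTransform.fourierInv_fourier_eq, FourierTransform.fourierInv_fourier_eq] at h1
  simpa using congrArg (fun u : 𝓢(ℝ, ℂ) => u ξ.2) h1

theorem analysis_synthesis {h : 𝓢(E d, ℂ)} (hh : FlatAtZero h) (x : E d) :
    analysis d ⟨synthesis d h, synthesis_mem_lizorkinXi hh⟩ x = (‖x‖⁻¹) ^ (d - 1) • h x := by
  by_cases hx : x = 0
  · rw [hx, (flatAtZero_analysis _).apply_zero, hh.apply_zero, smul_zero]
  have h0 : 0 < ‖x‖ := norm_pos_iff.2 hx
  let n : Sph d := ⟨‖x‖⁻¹ • x, by simp [norm_smul, hx]⟩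
  have h1 : x = ‖x‖ • (n : E d) := by
    simp only [n, smul_smul, mul_inv_cancel₀ h0.ne', one_smul]
  have h2 := analysis_smul ⟨synthesis d h, synthesis_mem_lizorkinXi hh⟩ n h0
  rw [fourier_sliceXi_synthesis, ray_apply, ← h1] at h2
  exact h2

/-- The product wn is unchanged when n and w both change sign. -/
theorem synthesis_mem_even {h : 𝓢(E d, ℂ)} (hh : FlatAtZero h) :
    (⟨synthesis d h, synthesis_mem_lizorkinXi hh⟩ : LizorkinXi d) ∈ LizorkinXiEven d := by
  refine Subtype.ext (DFunLike.ext _ _ fun ξ => ?_)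
  change synthesis d h (-ξ.1, -ξ.2) = synthesis d h (ξ.1, ξ.2)
  rw [synthesis_apply, synthesis_apply, Real.fourierInv_eq_fourier_neg, neg_neg,
    Real.fourierInv_eq_fourier_comp_neg]
  simp

/-- The function `|x|^(2 (d - 1))`. -/
def normPow (d : ℕ) (x : E d) : ℂ := ((‖x‖ ^ 2 : ℝ) : ℂ) ^ (d - 1)

/-- The even exponent makes this a polynomial. In the ramp filter one factor |x|^(d-1) undoes the
weight of `analysis` and the other is the symbol, so no non-smooth multiplier is needed. -/
theorem hasTemperateGrowth_normPow {d : ℕ} : Function.HasTemperateGrowth (normPow d) :=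
  (Function.Complex.hasTemperateGrowth_ofReal.comp
    (Function.hasTemperateGrowth_norm_sq (E d))).pow (d - 1)

theorem flatAtZero_normPow_mul_analysis (ψ : LizorkinXi d) :
    FlatAtZero (SchwartzMap.smulLeftCLM ℂ (normPow d) (analysis d ψ)) := by
  have := (flatAtZero_analysis ψ).mul ((analysis d ψ).smooth ⊤)
    (hasTemperateGrowth_normPow (d := d)).1
  refine fun m => Eq.trans (congrArg (fun f => iteratedFDeriv ℝ m f 0) (funext fun x => ?_))
    (this m)
  rw [SchwartzMap.smulLeftCLM_apply_apply hasTemperateGrowth_normPow, smul_eq_mul, mul_comm]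

/-- The Radon transform on `𝓢₀(ℝ^d)`. -/
def radonCLM (d : ℕ) [NeZero d] : LizorkinE d →L[ℂ] LizorkinXi d :=
  ((synthesis d).comp ((SchwartzMap.fourierTransformCLM ℂ).comp (LizorkinE d).subtypeL)).codRestrict
    (LizorkinXi d) fun φ => synthesis_mem_lizorkinXi (flatAtZero_fourier φ.2)

/-- The dual Radon transform on even functions in `𝓢₀(Ξ)`. -/
def dualRadonCLM (d : ℕ) [NeZero d] : LizorkinXi d →L[ℂ] LizorkinE d :=
  ((2 : ℂ) • ((FourierTransform.fourierCLE ℂ 𝓢(E d, ℂ)).symm.toContinuousLinearMap.comp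
    (analysis d))).codRestrict (LizorkinE d) fun ψ =>
      (LizorkinE d).smul_mem _ (fourierInv_mem_lizorkinE (flatAtZero_analysis ψ))

/-- The ramp filter on even functions in `𝓢₀(Ξ)`. -/
def rampCLM (d : ℕ) [NeZero d] : LizorkinXi d →L[ℂ] LizorkinXi d :=
  ((2 * Real.pi : ℂ) ^ (d - 1) • ((synthesis d).comp
    ((SchwartzMap.smulLeftCLM ℂ (normPow d)).comp (analysis d)))).codRestrict (LizorkinXi d)
    fun ψ => (LizorkinXi d).smul_mem _
      (synthesis_mem_lizorkinXi (flatAtZero_normPow_mul_analysis ψ))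

end Operators

/-! ### The Radon transform -/

section Radon

variable {d : ℕ}

theorem norm_sph (n : Sph d) : ‖(n : E d)‖ = 1 := norm_eq_of_mem_sphere n

/-- The orthogonal decomposition along ℝn and its complement is an isometry, and n is a unit vector;
this is Fubini for hyperplane integrals. -/
theorem measurePreserving_smul_add (n : Sph d) : MeasurePreserving
    (fun p : ℝ × (Submodule.span ℝ {(n : E d)})ᗮ => p.1 • (n : E d) + (p.2 : E d)) := by
  have h1 := (LinearIsometryEquiv.toSpanUnitSingleton (𝕜 := ℝ) (n : E d)
    (norm_sph n)).measurePreserving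
  have h2 := h1.prod (MeasurePreserving.id (volume : Measure (Submodule.span ℝ {(n : E d)})ᗮ))
  have h3 := WithLp.volume_preserving_toLp (Submodule.span ℝ {(n : E d)})
    (Submodule.span ℝ {(n : E d)})ᗮ
  have h4 := (Submodule.span ℝ {(n : E d)}).orthogonalDecomposition.symm.measurePreserving
  convert h4.comp (h3.comp h2) using 1
  · funext p
    simp
  · rfl

theorem inner_sph_orthogonal (n : Sph d) (y : (Submodule.span ℝ {(n : E d)})ᗮ) :
    inner ℝ (n : E d) (y : E d) = 0 :=
  Submodule.inner_right_of_mem_orthogonal (Submodule.mem_span_singleton_self _) y.2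

theorem norm_le_norm_smul_add (n : Sph d) (t : ℝ) (y : (Submodule.span ℝ {(n : E d)})ᗮ) :
    ‖y‖ ≤ ‖t • (n : E d) + (y : E d)‖ := by
  have h := norm_add_sq_eq_norm_sq_add_norm_sq_of_inner_eq_zero (t • (n : E d)) (y : E d)
    (by rw [real_inner_smul_left, inner_sph_orthogonal, mul_zero])
  refine abs_le_of_sq_le_sq' ?_ (norm_nonneg _) |>.2
  rw [Submodule.coe_norm]
  nlinarith [norm_nonneg (t • (n : E d))]

/-- Dominated convergence: by Pythagoras the decay of φ in y is uniform in t, and one power beyond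
the dimension of the hyperplane is integrable. Continuity is what makes Fourier inversion hold at
every t. -/
theorem continuous_radon (φ : 𝓢(E d, ℂ)) (n : Sph d) : Continuous fun t => radon φ (n, t) := by
  let Y := (Submodule.span ℝ {(n : E d)})ᗮ
  obtain ⟨C, hC⟩ : ∃ C : ℝ, ∀ x, (1 + ‖x‖) ^ (Module.finrank ℝ Y + 1) * ‖φ x‖ ≤ C := by
    have := SchwartzMap.one_add_le_sup_seminorm_apply (𝕜 := ℝ)
      (m := (Module.finrank ℝ Y + 1, 0)) (k := Module.finrank ℝ Y + 1) (n := 0) le_rfl le_rfl φ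
    simp only [norm_iteratedFDeriv_zero] at this
    exact ⟨_, this⟩
  have hint : Integrable fun y : Y => (1 + ‖y‖) ^ (-((Module.finrank ℝ Y + 1 : ℕ) : ℝ)) :=
    integrable_one_add_norm (by push_cast; linarith)
  refine continuous_of_dominated (bound := fun y : Y =>
    C * (1 + ‖y‖) ^ (-((Module.finrank ℝ Y + 1 : ℕ) : ℝ))) (fun t => ?_)
    (fun t => Filter.Eventually.of_forall fun y => ?_) (hint.const_mul C)
    (Filter.Eventually.of_forall fun y => ?_)
  · exact (φ.continuous.comp (by fun_prop)).aestronglyMeasurable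
  · have h0 : (0 : ℝ) < 1 + ‖y‖ := by positivity
    rw [Real.rpow_neg h0.le, Real.rpow_natCast, ← div_eq_mul_inv, le_div_iff₀ (by positivity),
      mul_comm]
    refine le_trans ?_ (hC (t • (n : E d) + (y : E d)))
    have := norm_le_norm_smul_add n t y
    gcongr
  · exact φ.continuous.comp (by fun_prop)

theorem integrable_smul_add {f : E d → ℂ} (hf : Integrable f) (n : Sph d) :
    Integrable fun p : ℝ × (Submodule.span ℝ {(n : E d)})ᗮ =>
      f (p.1 • (n : E d) + (p.2 : E d)) :=
  (measurePreserving_smul_add n).integrable_comp_of_integrable hf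

theorem integral_smul_add {f : E d → ℂ} (hf : Integrable f) (n : Sph d) :
    ∫ t, radon f (n, t) = ∫ x, f x := by
  rw [← (measurePreserving_smul_add n).map_eq, integral_map
    (measurePreserving_smul_add n).aemeasurable
    (by rw [(measurePreserving_smul_add n).map_eq]; exact hf.1)]
  exact (integral_prod _ (integrable_smul_add hf n)).symm

/-- Fourier slice theorem: the character x ↦ exp(-2πi w n·x) is constant on each hyperplane n·x = t,
so Fubini applies. -/
theorem fourier_radon (φ : 𝓢(E d, ℂ)) (n : Sph d) (w : ℝ) :
    𝓕 (fun t => radon φ (n, t)) w = 𝓕 φ (w • (n : E d)) := by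
  have h1 : Integrable fun x : E d => Real.fourierChar (-(inner ℝ x (w • (n : E d)))) • φ x :=
    (Real.fourierIntegral_convergent_iff (w • (n : E d))).2 φ.integrable
  rw [SchwartzMap.fourier_coe, Real.fourier_eq, Real.fourier_eq, ← integral_smul_add h1 n]
  congr 1
  funext t
  simp only [radon]
  rw [Circle.smul_def, ← integral_smul]
  congr 1
  funext y
  rw [Circle.smul_def]
  congr 4
  rw [inner_add_left, real_inner_smul_right, real_inner_smul_right, real_inner_smul_left,
    real_inner_self_eq_norm_sq, norm_sph, real_inner_comm (n : E d) (y : E d), inner_sph_orthogonal]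
  simp

variable [NeZero d]

theorem radon_eq_synthesis (φ : 𝓢(E d, ℂ)) (ξ : Xi d) :
    radon φ ξ = synthesis d (𝓕 φ) ξ := by
  obtain ⟨n, t⟩ := ξ
  have h1 : 𝓕 (fun t => radon φ (n, t)) = ray n (𝓕 φ) := funext (fourier_radon φ n)
  have h2 : Integrable fun t => radon φ (n, t) :=
    (integrable_smul_add φ.integrable n).integral_prod_left
  have h3 := (continuous_radon φ n).fourierInv_fourier_eq h2 (by
    rw [h1]; exact (ray n (𝓕 φ)).integrable)
  rw [synthesis_apply, ← congrFun h3 t, h1]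
  rfl

end Radon

/-! ### The dual Radon transform -/

theorem integral_eq_integral_Ioi_add {f : ℝ → ℂ} (hf : Integrable f) :
    ∫ t, f t = (∫ t in Set.Ioi 0, f t) + ∫ t in Set.Ioi 0, f (-t) := by
  rw [integral_comp_neg_Ioi, neg_zero, add_comm, intervalIntegral.integral_Iic_add_Ioi
    hf.integrableOn hf.integrableOn]

section Polar

variable {d : ℕ}

/-- The integral of `f` over the ray through `n`, with respect to `r ^ (d - 1) dr`. -/
def rayIntegral (f : E d → ℂ) (n : Sph d) : ℂ :=
  ∫ r in Set.Ioi (0 : ℝ), r ^ (d - 1) • f (r • (n : E d))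

theorem rayIntegral_eq (f : E d → ℂ) (n : Sph d) : rayIntegral f n =
    ∫ r : Set.Ioi (0 : ℝ), f ((r : ℝ) • (n : E d)) ∂(Measure.volumeIoiPow (d - 1)) := by
  symm
  simp only [Measure.volumeIoiPow, ENNReal.ofReal]
  rw [integral_withDensity_eq_integral_smul
    (measurable_subtype_coe.pow_const _).real_toNNReal,
    integral_subtype_comap measurableSet_Ioi fun a : ℝ =>
      Real.toNNReal (a ^ (d - 1)) • f (a • (n : E d))]
  refine setIntegral_congr_fun measurableSet_Ioi fun x hx => ?_
  rw [NNReal.smul_def, Real.coe_toNNReal _ (pow_nonneg hx.out.le _)]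

theorem integrable_polar {f : E d → ℂ} (hf : Integrable f) : Integrable
    (fun p : Sph d × Set.Ioi (0 : ℝ) => f ((p.2 : ℝ) • (p.1 : E d)))
    ((volume : Measure (E d)).toSphere.prod (Measure.volumeIoiPow (d - 1))) := by
  have h := (volume : Measure (E d)).measurePreserving_homeomorphUnitSphereProd
  rw [finrank_euclideanSpace_fin] at h
  have h1 : Integrable (fun x : ({0}ᶜ : Set (E d)) => f x) (Measure.comap Subtype.val volume) :=
    (integrableOn_iff_comap_subtypeVal (measurableSet_singleton _).compl).1 hf.integrableOn
  rw [← h.integrable_comp_emb (Homeomorph.measurableEmbedding _)]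
  refine h1.congr (Filter.Eventually.of_forall fun x => ?_)
  have := congrArg Subtype.val ((homeomorphUnitSphereProd (E d)).symm_apply_apply x)
  rw [homeomorphUnitSphereProd_symm_apply_coe] at this
  simp only [Function.comp, this]

theorem integrable_rayIntegral {f : E d → ℂ} (hf : Integrable f) :
    Integrable (rayIntegral f) (volume : Measure (E d)).toSphere := by
  rw [funext (rayIntegral_eq f)]
  exact (integrable_polar hf).integral_prod_left

variable [NeZero d]

theorem integral_rayIntegral {f : E d → ℂ} (hf : Integrable f) :
    ∫ n, rayIntegral f n ∂(volume : Measure (E d)).toSphere = ∫ x, f x := by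
  -- Positive dimension makes the origin, which polar coordinates omit, a null set.
  have : Nontrivial (E d) := Module.nontrivial_of_finrank_pos (R := ℝ)
    (by rw [finrank_euclideanSpace_fin]; exact NeZero.pos d)
  simp only [rayIntegral_eq]
  have h := (volume : Measure (E d)).measurePreserving_homeomorphUnitSphereProd
  rw [finrank_euclideanSpace_fin] at h
  have h1 : ∫ x, f x = ∫ x : ({0}ᶜ : Set (E d)), f x ∂(Measure.comap Subtype.val volume) := by
    rw [integral_subtype_comap (measurableSet_singleton _).compl f, restrict_compl_singleton]
  rw [← integral_prod _ (integrable_polar hf), ← h.integral_comp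
    (Homeomorph.measurableEmbedding _), h1]
  congr 1
  funext x
  have := congrArg Subtype.val ((homeomorphUnitSphereProd (E d)).symm_apply_apply x)
  rw [homeomorphUnitSphereProd_symm_apply_coe] at this
  rw [this]

theorem sliceXi_eq_fourierInv (ψ : SchwartzXi d) (n : Sph d) (t : ℝ) :
    ψ (n, t) = ∫ w : ℝ, Real.fourierChar (w * t) • 𝓕 (sliceXi ψ n) w := by
  have h : 𝓕⁻ (𝓕 (sliceXi ψ n)) = sliceXi ψ n := FourierTransform.fourierInv_fourier_eq _
  have h1 := congrArg (fun u : 𝓢(ℝ, ℂ) => u t) h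
  simp only [sliceXi_apply, SchwartzMap.fourierInv_coe] at h1
  rw [← h1, Real.fourierInv_eq]
  simp [mul_comm]

/-- Expand ψ(n, n·x) by Fourier inversion on the line over n. By evenness the integrand is |w|^(d-1)
f(wn), so integrating over n is integration in polar coordinates. -/
theorem dualRadon_eq (ψ : LizorkinXi d) (hψ : ψ ∈ LizorkinXiEven d) (x : E d) :
    dualRadon ψ.1 x = 2 * (𝓕⁻ (analysis d ψ)) x := by
  let f : E d → ℂ := fun y => Real.fourierChar (inner ℝ y x) • analysis d ψ y
  have hf : Integrable f := by
    have := (Real.fourierIntegral_convergent_iff (-x)).2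
      ((analysis d ψ).integrable (μ := volume))
    simpa [f] using this
  have h2 : (𝓕⁻ (analysis d ψ)) x = ∫ y, f y := by
    rw [SchwartzMap.fourierInv_coe, Real.fourierInv_eq]
  have h3 : ∀ n : Sph d, ψ.1 (n, inner ℝ n.1 x) =
      rayIntegral f n + rayIntegral (fun y => f (-y)) n := by
    intro n
    rw [sliceXi_eq_fourierInv]
    have h4 : ∀ w : ℝ, Real.fourierChar (w * inner ℝ n.1 x) • 𝓕 (sliceXi ψ.1 n) w =
        |w| ^ (d - 1) • f (w • (n : E d)) := by
      intro w
      rw [fourier_sliceXi_of_even hψ, smul_comm]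
      simp only [f, real_inner_smul_left]
    rw [integral_eq_integral_Ioi_add]
    · congr 1
      · refine setIntegral_congr_fun measurableSet_Ioi fun r hr => ?_
        simp only [h4, abs_of_pos hr.out]
      · refine setIntegral_congr_fun measurableSet_Ioi fun r hr => ?_
        simp only [h4, abs_neg, abs_of_pos hr.out, neg_smul]
    · have := (Real.fourierIntegral_convergent_iff (-inner ℝ n.1 x : ℝ)).2
        ((𝓕 (sliceXi ψ.1 n)).integrable (μ := volume))
      simpa [mul_comm] using this
  simp only [dualRadon, h3]
  have hf' : Integrable fun y => f (-y) := hf.comp_neg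
  -- The half-lines w > 0 and w < 0 contribute the integrals of f(y) and f(-y), which are equal;
  -- hence the factor 2.
  rw [integral_add (integrable_rayIntegral hf) (integrable_rayIntegral hf'),
    integral_rayIntegral hf, integral_rayIntegral hf', integral_neg_eq_self f, h2]
  ring

end Polar

/-! ### The ramp filter -/

section Ramp

theorem exists_schwartz_eq_iteratedDeriv (u : 𝓢(ℝ, ℂ)) (k : ℕ) :
    ∃ v : 𝓢(ℝ, ℂ), (v : ℝ → ℂ) = iteratedDeriv k u := by
  induction k with
  | zero => exact ⟨u, iteratedDeriv_zero.symm⟩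
  | succ k ih =>
    obtain ⟨v, hv⟩ := ih
    exact ⟨SchwartzMap.derivCLM ℂ ℂ v, by
      rw [iteratedDeriv_succ, ← hv]
      rfl⟩

theorem fourier_iteratedDeriv (u : 𝓢(ℝ, ℂ)) (k : ℕ) (w : ℝ) :
    𝓕 (iteratedDeriv k u) w = (2 * Real.pi * Complex.I * w) ^ k * 𝓕 u w := by
  rw [Real.fourier_iteratedDeriv (N := ⊤) (u.smooth ⊤) (fun n _ => ?_) le_top]
  · rfl
  · obtain ⟨v, hv⟩ := exists_schwartz_eq_iteratedDeriv u n
    rw [← hv]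
    exact v.integrable

theorem iteratedDeriv_eq_fourierInv (u : 𝓢(ℝ, ℂ)) (k : ℕ) :
    iteratedDeriv k u = 𝓕⁻ fun w : ℝ => (2 * Real.pi * Complex.I * w) ^ k * 𝓕 u w := by
  obtain ⟨v, hv⟩ := exists_schwartz_eq_iteratedDeriv u k
  have h : 𝓕⁻ (𝓕 v) = v := FourierTransform.fourierInv_fourier_eq _
  rw [← funext (fourier_iteratedDeriv u k), ← hv, ← SchwartzMap.fourier_coe,
    ← SchwartzMap.fourierInv_coe, h]

theorem const_mul_fourierInv (c : ℂ) (f : ℝ → ℂ) (t : ℝ) :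
    c * 𝓕⁻ f t = 𝓕⁻ (fun w => c * f w) t := by
  rw [Real.fourierInv_eq, Real.fourierInv_eq, ← integral_const_mul]
  simp only [Circle.smul_def, smul_eq_mul, mul_left_comm]

theorem neg_one_pow_mul_I_pow (m : ℕ) : (-1 : ℂ) ^ m * (Complex.I ^ 2) ^ m = 1 := by
  rw [Complex.I_sq, ← mul_pow]
  simp

theorem sign_mul_pow (w : ℝ) (m : ℕ) :
    ((Real.sign w : ℝ) : ℂ) * (w : ℂ) ^ (2 * m + 1) = (|w| : ℝ) ^ (2 * m + 1) := by
  norm_cast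
  rw [pow_succ, pow_succ, pow_mul, pow_mul, sq_abs, mul_left_comm]
  congr 1
  rcases lt_trichotomy w 0 with h | rfl | h
  · rw [Real.sign_of_neg h, abs_of_neg h]; ring
  · simp
  · rw [Real.sign_of_pos h, abs_of_pos h, one_mul]

variable {d : ℕ}

theorem normPow_smul (n : Sph d) (w : ℝ) :
    normPow d (w • (n : E d)) = (|w| : ℝ) ^ (d - 1) * (|w| : ℝ) ^ (d - 1) := by
  rw [normPow, norm_smul, norm_sph, mul_one, Real.norm_eq_abs, ← mul_pow, sq]
  push_cast
  rfl

variable [NeZero d]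

/-- The sign prefactor cancels the powers of i in (2πiw)^(d-1). For odd d the exponent is even and w
may be replaced by |w|; for even d the multiplier -i sgn w removes the remaining i and the sign of
w. -/
theorem ramp_eq_fourierInv (ψ : SchwartzXi d) (n : Sph d) (t : ℝ) :
    ramp ψ (n, t) = 𝓕⁻ (fun w : ℝ =>
      (2 * Real.pi : ℂ) ^ (d - 1) * ((|w| : ℝ) ^ (d - 1) * 𝓕 (sliceXi ψ n) w)) t := by
  have hu : (fun s => ψ (n, s)) = sliceXi ψ n := funext fun s => (sliceXi_apply ψ n s).symm
  unfold ramp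
  simp only [hu]
  split_ifs with h
  · obtain ⟨m, rfl⟩ := h
    rw [iteratedDeriv_eq_fourierInv, const_mul_fourierInv]
    refine congrArg (fun f : ℝ → ℂ => 𝓕⁻ f t) (funext fun w => ?_)
    have h1 : ((|w| : ℝ) : ℂ) ^ (2 * m) = (w : ℂ) ^ (2 * m) := by
      norm_cast
      rw [pow_mul, pow_mul, sq_abs]
    simp only [Nat.add_sub_cancel, Nat.mul_div_cancel_left m two_pos]
    rw [h1]
    linear_combination ((2 * Real.pi : ℂ) ^ (2 * m) * (w : ℂ) ^ (2 * m) * 𝓕 (sliceXi ψ n) w) *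
      neg_one_pow_mul_I_pow m
  -- Since d is even and nonzero, d ≥ 2, so the truncated subtractions are genuine.
  · obtain ⟨m, hm⟩ : ∃ m, d - 1 = 2 * m + 1 := by
      obtain ⟨m, hm⟩ := Nat.not_odd_iff_even.1 h
      exact ⟨m - 1, by have := NeZero.ne d; omega⟩
    rw [hm, show (d - 2) / 2 = m by omega, hilbert, const_mul_fourierInv]
    refine congrArg (fun f : ℝ → ℂ => 𝓕⁻ f t) (funext fun w => ?_)
    rw [fourier_iteratedDeriv, ← sign_mul_pow]
    have h1 := neg_one_pow_mul_I_pow m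
    have h2 : Complex.I * Complex.I = -1 := Complex.I_mul_I
    rw [pow_succ (2 * Real.pi * Complex.I * w : ℂ), pow_mul, pow_succ (2 * Real.pi : ℂ),
      pow_succ (w : ℂ), pow_mul (2 * Real.pi : ℂ), pow_mul (w : ℂ), mul_pow _ (w : ℂ) 2,
      mul_pow _ (w ^ 2 : ℂ), mul_pow _ Complex.I 2, mul_pow _ (Complex.I ^ 2)]
    linear_combination (((2 * Real.pi : ℂ) ^ 2) ^ m * (2 * Real.pi) * ((w : ℂ) ^ 2) ^ m * w *
      Real.sign w * 𝓕 (sliceXi ψ n) w) * (h1 - (-1) ^ m * (Complex.I ^ 2) ^ m * h2)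

theorem rampCLM_apply (ψ : LizorkinXi d) (n : Sph d) (t : ℝ) :
    (rampCLM d ψ).1 (n, t) = (2 * Real.pi : ℂ) ^ (d - 1) *
      𝓕⁻ (fun w : ℝ => normPow d (w • (n : E d)) * analysis d ψ (w • (n : E d))) t := by
  change (2 * Real.pi : ℂ) ^ (d - 1) * synthesis d
    (SchwartzMap.smulLeftCLM ℂ (normPow d) (analysis d ψ)) (n, t) = _
  rw [synthesis_apply]
  simp only [SchwartzMap.smulLeftCLM_apply_apply hasTemperateGrowth_normPow, smul_eq_mul]

theorem ramp_eq_rampCLM {ψ : LizorkinXi d} (hψ : ψ ∈ LizorkinXiEven d) (ξ : Xi d) :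
    ramp ψ.1 ξ = (rampCLM d ψ).1 ξ := by
  obtain ⟨n, t⟩ := ξ
  rw [ramp_eq_fourierInv, rampCLM_apply, const_mul_fourierInv]
  refine congrArg (fun f : ℝ → ℂ => 𝓕⁻ f t) (funext fun w => ?_)
  rw [fourier_sliceXi_of_even hψ, normPow_smul, Complex.real_smul]
  push_cast
  ring

end Ramp

/-! ### Even test functions and distributions -/

section Even

variable {d : ℕ} [NeZero d]

/-- The reflection on `𝓢(Ξ)`. -/
def reflectXiCLM (d : ℕ) [NeZero d] : SchwartzXi d →L[ℂ] SchwartzXi d where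
  toFun := SchwartzXi.reflect
  map_add' _ _ := rfl
  map_smul' _ _ := rfl
  cont := continuous_of_seminorm_le (schwartzXi_withSeminorms d)
    { toFun := SchwartzXi.reflect
      map_add' := fun _ _ => rfl
      map_smul' := fun _ _ => rfl } fun i =>
    ⟨SchwartzXi.seminorm d i.1 i.2, continuous_schwartzXi_seminorm i.1 i.2, map_zero _, fun ψ => by
      refine Real.iSup_le (fun ξ => ?_) (apply_nonneg _ _)
      exact (decayAt_reflect i.1 i.2 ψ ξ).trans_le (ψ.decayAt_le_seminorm i.1 i.2 _)⟩

/-- The reflection on `𝓢₀(Ξ)`. -/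
def reflectCLM (d : ℕ) [NeZero d] : LizorkinXi d →L[ℂ] LizorkinXi d :=
  ((reflectXiCLM d).comp (LizorkinXi d).subtypeL).codRestrict (LizorkinXi d)
    fun ψ => (reflectLizorkin ψ).2

theorem reflectCLM_apply (ψ : LizorkinXi d) : reflectCLM d ψ = reflectLizorkin ψ := rfl

theorem reflectLizorkin_reflectLizorkin (ψ : LizorkinXi d) :
    reflectLizorkin (reflectLizorkin ψ) = ψ :=
  Subtype.ext (DFunLike.ext _ _ fun ξ => by
    change ψ.1 (- -ξ.1, - -ξ.2) = ψ.1 ξ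
    rw [neg_neg, neg_neg])

theorem smul_mem_lizorkinXiEven (c : ℂ) {ψ : LizorkinXi d} (hψ : ψ ∈ LizorkinXiEven d) :
    c • ψ ∈ LizorkinXiEven d := by
  have h : reflectCLM d ψ = ψ := hψ
  change reflectCLM d (c • ψ) = c • ψ
  rw [map_smul, h]

/-- The even part of a function in `𝓢₀(Ξ)`. -/
def evenPart (d : ℕ) [NeZero d] : LizorkinXi d →L[ℂ] LizorkinXi d :=
  (2⁻¹ : ℂ) • (ContinuousLinearMap.id ℂ _ + reflectCLM d)

theorem evenPart_apply (ψ : LizorkinXi d) :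
    evenPart d ψ = (2⁻¹ : ℂ) • (ψ + reflectLizorkin ψ) := rfl

theorem evenPart_mem (ψ : LizorkinXi d) : evenPart d ψ ∈ LizorkinXiEven d := by
  refine smul_mem_lizorkinXiEven _ ?_
  change reflectCLM d (ψ + reflectLizorkin ψ) = ψ + reflectLizorkin ψ
  rw [map_add, reflectCLM_apply, reflectCLM_apply, reflectLizorkin_reflectLizorkin, add_comm]

theorem evenPart_of_even {ψ : LizorkinXi d} (hψ : ψ ∈ LizorkinXiEven d) : evenPart d ψ = ψ := by
  have h : reflectLizorkin ψ = ψ := hψ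
  rw [evenPart_apply, h, ← two_smul ℂ ψ, smul_smul, inv_mul_cancel₀ two_ne_zero, one_smul]

theorem evenPart_reflectLizorkin (ψ : LizorkinXi d) :
    evenPart d (reflectLizorkin ψ) = evenPart d ψ := by
  rw [evenPart_apply, evenPart_apply, reflectLizorkin_reflectLizorkin, add_comm]

theorem apply_evenPart (F : LizorkinDistXiEven d) (ψ : LizorkinXi d) :
    F.1 (evenPart d ψ) = F.1 ψ := by
  rw [evenPart_apply, map_smul, map_add, F.2 ψ, ← two_smul ℂ (F.1 ψ), smul_smul,
    inv_mul_cancel₀ two_ne_zero, one_smul]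

theorem LizorkinDistXiEven.ext_of_even {F G : LizorkinDistXiEven d}
    (h : ∀ ψ ∈ LizorkinXiEven d, F.1 ψ = G.1 ψ) : F = G := by
  refine Subtype.ext (ContinuousLinearMap.ext fun ψ => ?_)
  rw [← apply_evenPart F, ← apply_evenPart G, h _ (evenPart_mem ψ)]

/-- Precompose T with the even part, which fixes even functions and ignores reflection. This is what
defines the transposed operators, whose formulae are prescribed only on even test functions. -/
theorem existsUnique_eq_on_even (T : LizorkinDistXi d) :
    ∃! F : LizorkinDistXiEven d, ∀ ψ ∈ LizorkinXiEven d, F.1 ψ = T ψ := by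
  refine ⟨⟨T.comp (evenPart d), fun ψ => ?_⟩, fun ψ hψ => ?_, fun G hG => ?_⟩
  · exact congrArg T (evenPart_reflectLizorkin ψ)
  · exact congrArg T (evenPart_of_even hψ)
  · exact LizorkinDistXiEven.ext_of_even fun ψ hψ =>
      (hG ψ hψ).trans (congrArg T (evenPart_of_even hψ)).symm

theorem radonCLM_mem_even (φ : LizorkinE d) : radonCLM d φ ∈ LizorkinXiEven d :=
  synthesis_mem_even (flatAtZero_fourier φ.2)

theorem rampCLM_eq (ψ : LizorkinXi d) : rampCLM d ψ = (2 * Real.pi : ℂ) ^ (d - 1) •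
    (⟨synthesis d (SchwartzMap.smulLeftCLM ℂ (normPow d) (analysis d ψ)),
      synthesis_mem_lizorkinXi (flatAtZero_normPow_mul_analysis ψ)⟩ : LizorkinXi d) := rfl

theorem rampCLM_mem_even (ψ : LizorkinXi d) : rampCLM d ψ ∈ LizorkinXiEven d := by
  rw [rampCLM_eq]
  exact smul_mem_lizorkinXiEven _ (synthesis_mem_even (flatAtZero_normPow_mul_analysis ψ))

end Even

/-! ### Inversion on test functions -/

section Inversion

variable {d : ℕ} [NeZero d]

/-- The weight |x|^(1-d) from `analysis_synthesis` cancels half of |x|^(2(d-1)); at the origin both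
sides vanish by flatness. -/
theorem analysis_rampCLM (ψ : LizorkinXi d) (x : E d) : analysis d (rampCLM d ψ) x =
    (2 * Real.pi : ℂ) ^ (d - 1) * (((‖x‖ : ℝ) : ℂ) ^ (d - 1) * analysis d ψ x) := by
  rw [rampCLM_eq, map_smul, smul_apply,
    analysis_synthesis (flatAtZero_normPow_mul_analysis ψ),
    SchwartzMap.smulLeftCLM_apply_apply hasTemperateGrowth_normPow, smul_eq_mul]
  by_cases hx : x = 0
  · rw [hx, (flatAtZero_analysis ψ).apply_zero]
    simp
  have h0 : ((‖x‖ : ℝ) : ℂ) ≠ 0 := by exact_mod_cast norm_ne_zero_iff.2 hx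
  rw [normPow, Complex.real_smul, smul_eq_mul]
  push_cast
  rw [← mul_assoc _ _ (analysis d ψ x), ← mul_pow, sq, inv_mul_cancel_left₀ h0]

theorem analysis_radonCLM (φ : LizorkinE d) (x : E d) :
    ((‖x‖ : ℝ) : ℂ) ^ (d - 1) * analysis d (radonCLM d φ) x = 𝓕 φ.1 x := by
  have h := analysis_synthesis (flatAtZero_fourier φ.2) x
  change analysis d (radonCLM d φ) x = _ at h
  rw [h]
  by_cases hx : x = 0
  · rw [hx, (flatAtZero_fourier φ.2).apply_zero]
    simp
  have h0 : ((‖x‖ : ℝ) : ℂ) ≠ 0 := by exact_mod_cast norm_ne_zero_iff.2 hx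
  rw [Complex.real_smul]
  push_cast
  rw [← mul_assoc, ← mul_pow, mul_inv_cancel₀ h0, one_pow, one_mul]

theorem dualRadonCLM_coe (ψ : LizorkinXi d) :
    (dualRadonCLM d ψ).1 = (2 : ℂ) • 𝓕⁻ (analysis d ψ) := rfl

theorem dualRadonCLM_rampCLM_radonCLM (φ : LizorkinE d) :
    dualRadonCLM d (rampCLM d (radonCLM d φ)) = (2 * (2 * (Real.pi : ℂ)) ^ (d - 1)) • φ := by
  have h : analysis d (rampCLM d (radonCLM d φ)) = (2 * Real.pi : ℂ) ^ (d - 1) • 𝓕 φ.1 := by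
    ext x
    rw [analysis_rampCLM, analysis_radonCLM]
    rfl
  refine Subtype.ext ?_
  rw [dualRadonCLM_coe, h, FourierTransform.fourierInv_smul,
    FourierTransform.fourierInv_fourier_eq, smul_smul]
  rfl

/-- Compared on the Fourier side of each line, the ramp supplies exactly the factor |w|^(d-1) that
`analysis` had divided out. Evenness is needed to recover the transform of ψ for all w. -/
theorem radonCLM_dualRadonCLM_rampCLM {ψ : LizorkinXi d} (hψ : ψ ∈ LizorkinXiEven d) :
    radonCLM d (dualRadonCLM d (rampCLM d ψ)) = (2 * (2 * (Real.pi : ℂ)) ^ (d - 1)) • ψ := by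
  have h1 : (radonCLM d (dualRadonCLM d (rampCLM d ψ))).1 =
      synthesis d ((2 : ℂ) • analysis d (rampCLM d ψ)) := by
    change synthesis d (𝓕 (dualRadonCLM d (rampCLM d ψ)).1) = _
    rw [dualRadonCLM_coe, FourierTransform.fourier_smul, FourierTransform.fourier_fourierInv_eq]
  refine Subtype.ext (SchwartzXi.ext_fourier fun n => ?_)
  have h2 : sliceXi ((2 * (2 * (Real.pi : ℂ)) ^ (d - 1)) • ψ).1 n =
      (2 * (2 * (Real.pi : ℂ)) ^ (d - 1)) • sliceXi ψ.1 n := by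
    ext t
    simp [SchwartzXi.coe_smul]
  rw [h1, fourier_sliceXi_synthesis, h2, FourierTransform.fourier_smul]
  ext w
  rw [ray_apply, smul_apply, smul_apply, analysis_rampCLM,
    fourier_sliceXi_of_even hψ, norm_smul, norm_sph, mul_one, Real.norm_eq_abs, Complex.real_smul]
  push_cast
  simp only [smul_eq_mul]
  ring

end Inversion

/-! ### The operators on distributions -/

section Dist

variable {d : ℕ} [NeZero d]

theorem dualRadonCLM_apply {ψ : LizorkinXi d} (hψ : ψ ∈ LizorkinXiEven d) (x : E d) :
    (dualRadonCLM d ψ).1 x = dualRadon ψ.1 x := (dualRadon_eq ψ hψ x).symm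

theorem radonCLM_apply (φ : LizorkinE d) (ξ : Xi d) : (radonCLM d φ).1 ξ = radon φ.1 ξ :=
  (radon_eq_synthesis φ.1 ξ).symm

/-- The test function in the definition is fixed by its pointwise values, so the existential
collapses to the concrete continuous operator. -/
theorem isRadon_iff {f : LizorkinDistE d} {F : LizorkinDistXiEven d} :
    IsRadon f F ↔ ∀ ψ ∈ LizorkinXiEven d, F.1 ψ = f (dualRadonCLM d ψ) := by
  refine forall₂_congr fun ψ hψ => ⟨?_, fun h => ⟨_, dualRadonCLM_apply hψ, h⟩⟩
  rintro ⟨φ, h1, h2⟩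
  rw [h2, show φ = dualRadonCLM d ψ from Subtype.ext (SchwartzMap.ext fun x =>
    (h1 x).trans (dualRadonCLM_apply hψ x).symm)]

theorem isDualRadon_iff {g : LizorkinDistXiEven d} {h : LizorkinDistE d} :
    IsDualRadon g h ↔ ∀ φ, h φ = g.1 (radonCLM d φ) := by
  refine forall_congr' fun φ => ⟨?_, fun h => ⟨_, radonCLM_mem_even φ, radonCLM_apply φ, h⟩⟩
  rintro ⟨ψ, -, h1, h2⟩
  rw [h2, show ψ = radonCLM d φ from Subtype.ext (DFunLike.ext _ _ fun ξ =>
    (h1 ξ).trans (radonCLM_apply φ ξ).symm)]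

theorem isRamp_iff {g G : LizorkinDistXiEven d} :
    IsRamp g G ↔ ∀ ψ ∈ LizorkinXiEven d, G.1 ψ = g.1 (rampCLM d ψ) := by
  refine forall₂_congr fun ψ hψ => ⟨?_, fun h =>
    ⟨_, rampCLM_mem_even ψ, fun ξ => (ramp_eq_rampCLM hψ ξ).symm, h⟩⟩
  rintro ⟨χ, -, h1, h2⟩
  rw [h2, show χ = rampCLM d ψ from Subtype.ext (DFunLike.ext _ _ fun ξ =>
    (h1 ξ).trans (ramp_eq_rampCLM hψ ξ))]

theorem existsUnique_isRadon (f : LizorkinDistE d) : ∃! F, IsRadon f F := by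
  simp only [isRadon_iff]
  exact existsUnique_eq_on_even (f.comp (dualRadonCLM d))

theorem existsUnique_isDualRadon (g : LizorkinDistXiEven d) : ∃! h, IsDualRadon g h := by
  simp only [isDualRadon_iff]
  exact ⟨g.1.comp (radonCLM d), fun _ => rfl, fun _ hk => ContinuousLinearMap.ext hk⟩

theorem existsUnique_isRamp (g : LizorkinDistXiEven d) : ∃! G, IsRamp g G := by
  simp only [isRamp_iff]
  exact existsUnique_eq_on_even (g.1.comp (rampCLM d))

theorem radonDist_apply (f : LizorkinDistE d) {ψ : LizorkinXi d} (hψ : ψ ∈ LizorkinXiEven d) :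
    (radonDist f).1 ψ = f (dualRadonCLM d ψ) := by
  have h := (existsUnique_isRadon f).exists
  rw [radonDist, dif_pos h]
  exact isRadon_iff.1 h.choose_spec ψ hψ

theorem dualRadonDist_apply (g : LizorkinDistXiEven d) (φ : LizorkinE d) :
    dualRadonDist g φ = g.1 (radonCLM d φ) := by
  have h := (existsUnique_isDualRadon g).exists
  rw [dualRadonDist, dif_pos h]
  exact isDualRadon_iff.1 h.choose_spec φ

theorem rampDist_apply (g : LizorkinDistXiEven d) {ψ : LizorkinXi d}
    (hψ : ψ ∈ LizorkinXiEven d) : (rampDist g).1 ψ = g.1 (rampCLM d ψ) := by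
  have h := (existsUnique_isRamp g).exists
  rw [rampDist, dif_pos h]
  exact isRamp_iff.1 h.choose_spec ψ hψ

theorem inversion_constant_ne_zero (k : ℕ) : (2 * (2 * (Real.pi : ℂ)) ^ k) ≠ 0 := by
  simp [Real.pi_ne_zero]

theorem dualRadonDist_rampDist_radonDist (f : LizorkinDistE d) :
    f = (1 / (2 * (2 * (Real.pi : ℂ)) ^ (d - 1))) • dualRadonDist (rampDist (radonDist f)) := by
  ext φ
  rw [smul_apply, dualRadonDist_apply, rampDist_apply _ (radonCLM_mem_even φ),
    radonDist_apply _ (rampCLM_mem_even _), dualRadonCLM_rampCLM_radonCLM, map_smul, smul_smul,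
    one_div, inv_mul_cancel₀ (inversion_constant_ne_zero _), one_smul]

/-- Transposition reverses the order: tested on even ψ, the right side evaluates g on the Radon
transform of the dual transform of the filtered ψ. -/
theorem rampDist_radonDist_dualRadonDist (g : LizorkinDistXiEven d) :
    g = (1 / (2 * (2 * (Real.pi : ℂ)) ^ (d - 1))) • rampDist (radonDist (dualRadonDist g)) := by
  refine LizorkinDistXiEven.ext_of_even fun ψ hψ => ?_
  change g.1 ψ = (1 / (2 * (2 * (Real.pi : ℂ)) ^ (d - 1))) •
    (rampDist (radonDist (dualRadonDist g))).1 ψ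
  rw [rampDist_apply _ hψ, radonDist_apply _ (rampCLM_mem_even ψ), dualRadonDist_apply,
    radonCLM_dualRadonCLM_rampCLM hψ, map_smul, smul_smul, one_div,
    inv_mul_cancel₀ (inversion_constant_ne_zero _), one_smul]

end Dist

end LizorkinRadon

end

open LizorkinRadon in
/-- The first three conjuncts say that the operators on Lizorkin distributions are well defined;
the last two are the inversion formulae. -/
theorem mainTheorem5 (d : ℕ) [NeZero d] :
    (∀ f : LizorkinDistE d, ∃! F : LizorkinDistXiEven d, IsRadon f F) ∧
    (∀ g : LizorkinDistXiEven d, ∃! h : LizorkinDistE d, IsDualRadon g h) ∧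
    (∀ g : LizorkinDistXiEven d, ∃! G : LizorkinDistXiEven d, IsRamp g G) ∧
    (∀ f : LizorkinDistE d,
      f = (1 / (2 * (2 * (Real.pi : ℂ)) ^ (d - 1))) •
        dualRadonDist (rampDist (radonDist f))) ∧
    (∀ g : LizorkinDistXiEven d,
      g = (1 / (2 * (2 * (Real.pi : ℂ)) ^ (d - 1))) •
        rampDist (radonDist (dualRadonDist g))) := by
  exact ⟨existsUnique_isRadon, existsUnique_isDualRadon, existsUnique_isRamp,
    dualRadonDist_rampDist_radonDist, rampDist_radonDist_dualRadonDist⟩
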